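/- Let $\mathbb{F}_{q^m}/\mathbb{F}_q$ be an extension of finite fields of degree $m\ge 1$, and let $a,b\ge 1$ be coprime integers. Let $\mathcal X$ be a $C_{a,b}$ curve over $\mathbb{F}_{q^m}$, i.e. a curve with an irreducible, non-singular affine plane model $\alpha_{0a}y^a+\alpha_{b0}x^b+\sum_{ai+bj<ab}\alpha_{ij}x^iy^j=0$ with $\alpha_{0a},\alpha_{b0}\neq 0$; let $P_\infty$ be its unique point at infinity and $\mathfrak g=(a-1)(b-1)/2$ its genus. Every nonzero function $h$ that is regular outside $P_\infty$ is, up to a nonzero scalar, $x^\beta y^\alpha$ with $\alpha\le a-1$ plus a combination of monomials $x^iy^j$ with $j\le a-1$ and $ai+bj<a\beta+b\alpha$; then $x^\beta y^\alpha$ is its leading monomial, $\deg_{a,b}h:=a\beta+b\alpha$, and we set $$\mathcal R(h):=\operatorname{Span}\{x^uy^v\mid u\le \beta+b-1,\ v\le a-1,\ \text{not both } u\ge\beta \text{ and } v\ge\alpha\}.$$ Let $s<s'$ be integers and $g\in\mathcal L(s'P_\infty)$ with $\deg_{a,b}g=s'$. Let $\mathcal P$ be a finite set of $\mathbb{F}_{q^m}$-rational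 points of $\mathcal X$ disjoint from $\operatorname{Supp}(g)$; for a divisor $G$ let $C_{\mathcal L}(\mathcal X,\mathcal P,G)$ be the code of the vectors $(f(P))_{P\in\mathcal P}$, $f\in\mathcal L(G)$. Put $\mathcal C=C_{\mathcal L}(\mathcal X,\mathcal P,sP_\infty+(g))$, $k=\dim_{\mathbb{F}_{q^m}}\mathcal C$, and let $\Gamma=\mathcal C^\perp\cap\mathbb{F}_q^{\mathcal P}$ be the one-point Goppa-like code. Identifying functions with their evaluation vectors on $\mathcal P$ and writing $\operatorname{Tr}$ for the componentwise trace $\mathbb{F}_{q^m}\to\mathbb{F}_q$, let $$\mathcal T_0=\operatorname{Tr}\bigl(g^{-2}\mathcal L(2sP_\infty)\bigr),\qquad \mathcal T_i=\operatorname{Tr}\bigl(g^{-(q^i+1)}\bigl(\mathcal R(g^{q^i-q^{i-1}+1})\cap\mathcal L(s(q^i+1)P_\infty)\bigr)\bigr)\quad(i\ge1).$$ For a linear code $D$, let $D^{\star2}$ be the span of the componentwise products of pairs of elements of $D$. Let $e\in\{0,\dots,\lfloor m/2\rfloor\}$. Then $$\dim_{\mathbb{F}_q}(\Gamma^\perp)^{\star2}\le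 \max\Bigl(\frac{m-1}{2}-e,\,0\Bigr)mk^2+\dim_{\mathbb{F}_q}\Bigl(\sum_{i=0}^{e}\mathcal T_i\Bigr).$$ Moreover, suppose that some $i\in\{0,\dots,\lfloor m/2\rfloor-1\}$ satisfies $sq^{i}\ge(s'-s)(q^{i+1}-q^{i}+1)+2\mathfrak g-1$, and let $i^*$ be the smallest such $i$. If $i^*\le e$, then $$\dim_{\mathbb{F}_q}(\Gamma^\perp)^{\star2}\le \max\Bigl(\frac{m-1}{2}-e,\,0\Bigr)mk^2+ms'(q^e-q^{e-1}+1)+\dim_{\mathbb{F}_q}\Bigl(\sum_{i=0}^{i^*-1}\mathcal T_i\Bigr)-\dim_{\mathbb{F}_q}\Bigl(\mathcal T_e\cap\sum_{i=0}^{i^*-1}\mathcal T_i\Bigr).$$ -/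

import Mathlib

open scoped WithZero

/-! ### Places, Riemann–Roch spaces and evaluation codes of a function field `F` over `k` -/

/-- A place of `F` over `k`: a discrete valuation ring of `F` that contains the constants `k`. -/
structure Place (k F : Type*) [Field k] [Field F] [Algebra k F] where
  ring : ValuationSubring F
  isDVR : IsDiscreteValuationRing ring
  algebraMap_mem : ∀ c : k, algebraMap k F c ∈ ring

namespace Place

variable {k F : Type*} [Field k] [Field F] [Algebra k F]

/-- The multiplicative normalized valuation of a place: `P.val f = exp (-ν_P(f))`, `P.val 0 = 0`. -/
noncomputable def val (P : Place k F) : Valuation F ℤᵐ⁰ :=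
  haveI := P.isDVR
  (IsDiscreteValuationRing.maximalIdeal P.ring).valuation F

/-- The order `ν_P(f)` of a nonzero function `f` at `P` (by convention `0` for `f = 0`). -/
noncomputable def ord (P : Place k F) (f : F) : ℤ := -WithZero.log (P.val f)

/-- `P.HasValue f c` says `f(P) = c`: the function `f - c` lies in the maximal ideal of `P`. -/
def HasValue (P : Place k F) (f : F) (c : k) : Prop := P.val (f - algebraMap k F c) < 1

/-- Rational places: every function regular at `P` has a value in `k`. -/
def IsRational (P : Place k F) : Prop := ∀ f ∈ P.ring, ∃ c : k, P.HasValue f c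

lemma val_algebraMap_le_one (P : Place k F) (c : k) : P.val (algebraMap k F c) ≤ 1 := by
  have := P.isDVR
  exact (IsDiscreteValuationRing.maximalIdeal P.ring).valuation_le_one
    (K := F) (⟨algebraMap k F c, P.algebraMap_mem c⟩ : P.ring)

open Classical in
/-- The divisor `s · P`. A divisor is given by its coefficients. -/
noncomputable def divisor (P : Place k F) (s : ℤ) : Place k F → ℤ :=
  fun Q => if Q = P then s else 0

end Place

section FunctionField

variable {k F : Type*} [Field k] [Field F] [Algebra k F]

/-- The coefficients of the principal divisor `(g)`. -/
noncomputable def principalDivisor (k : Type*) {F : Type*} [Field k] [Field F] [Algebra k F]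
    (g : F) : Place k F → ℤ := fun P => P.ord g

/-- The Riemann–Roch space `𝓛(G) = {f | f = 0 or (f) + G ≥ 0}`. The condition
`-ν_P(f) ≤ G(P)` is written multiplicatively, so that it holds for `f = 0`. -/
noncomputable def riemannRoch (G : Place k F → ℤ) : Submodule k F where
  carrier := {f | ∀ P : Place k F, P.val f ≤ WithZero.exp (G P)}
  add_mem' := fun hf hg P => (P.val.map_add _ _).trans (max_le (hf P) (hg P))
  zero_mem' := fun P => by simp
  smul_mem' := fun c f hf P => by
    rw [Algebra.smul_def, map_mul]
    exact mul_le_of_le_one_of_le (P.val_algebraMap_le_one c) (hf P)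

/-- The code of all evaluation vectors `(f(P))_{P ∈ Pts}` with `f ∈ V`. -/
noncomputable def evalCode (Pts : Finset (Place k F)) (V : Submodule k F) :
    Submodule k (Pts → k) where
  carrier := {c | ∃ f ∈ V, ∀ P : Pts, P.1.HasValue f (c P)}
  add_mem' := by
    rintro c d ⟨f, hf, hfc⟩ ⟨g, hg, hgd⟩
    refine ⟨f + g, V.add_mem hf hg, fun P => ?_⟩
    have h : f + g - algebraMap k F ((c + d) P)
        = (f - algebraMap k F (c P)) + (g - algebraMap k F (d P)) := by
      rw [Pi.add_apply, map_add]; ring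
    rw [Place.HasValue, h]
    exact P.1.val.map_add_lt (hfc P) (hgd P)
  zero_mem' := ⟨0, V.zero_mem, fun P => by simp [Place.HasValue]⟩
  smul_mem' := by
    rintro r c ⟨f, hf, hfc⟩
    refine ⟨r • f, V.smul_mem r hf, fun P => ?_⟩
    have h : r • f - algebraMap k F ((r • c) P)
        = algebraMap k F r * (f - algebraMap k F (c P)) := by
      rw [Pi.smul_apply, smul_eq_mul, map_mul, Algebra.smul_def]; ring
    rw [Place.HasValue, h, map_mul]
    exact mul_lt_of_le_one_of_lt (P.1.val_algebraMap_le_one r) (hfc P)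

/-- The AG code `C_𝓛(𝒳, Pts, G)`. -/
noncomputable def agCode (Pts : Finset (Place k F)) (G : Place k F → ℤ) : Submodule k (Pts → k) :=
  evalCode Pts (riemannRoch G)

end FunctionField

/-! ### Linear codes -/

/-- The dual code for the usual scalar product. -/
def dualCode {k ι : Type*} [Field k] [Fintype ι] (C : Submodule k (ι → k)) :
    Submodule k (ι → k) where
  carrier := {x | ∀ c ∈ C, c ⬝ᵥ x = 0}
  add_mem' := fun hx hy c hc => by rw [dotProduct_add, hx c hc, hy c hc, add_zero]
  zero_mem' := fun c _ => dotProduct_zero c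
  smul_mem' := fun r x hx c hc => by rw [dotProduct_smul, hx c hc, smul_zero]

/-- The Schur product of two codes: the span of all componentwise products. -/
def schurProduct {k ι : Type*} [Field k] (C D : Submodule k (ι → k)) : Submodule k (ι → k) :=
  Submodule.span k {x | ∃ c ∈ C, ∃ d ∈ D, x = c * d}

/-- The subfield subcode `C ∩ K^ι`. -/
def subfieldSubcode (K : Type*) {L ι : Type*} [Field K] [Field L] [Algebra K L]
    (C : Submodule L (ι → L)) : Submodule K (ι → K) :=
  (C.restrictScalars K).comap ((Algebra.linearMap K L).compLeft ι)

/-- The trace code: the image of `C` under the componentwise trace `L → K`. -/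
noncomputable def traceCode (K : Type*) {L ι : Type*} [Field K] [Field L] [Algebra K L]
    (C : Submodule L (ι → L)) : Submodule K (ι → K) :=
  (C.restrictScalars K).map ((Algebra.trace K L).compLeft ι)

/-! ### `C_{a,b}` curves -/

/-- A `C_{a,b}` curve over `L`: an irreducible, non-singular affine plane model
`α_{0a} y^a + α_{b0} x^b + ∑_{ai+bj<ab} α_{ij} x^i y^j = 0` with `α_{0a}, α_{b0} ≠ 0`.
The variable `0` is `x` and the variable `1` is `y`. -/
structure CabCurve (L : Type*) [Field L] (a b : ℕ) where
  poly : MvPolynomial (Fin 2) L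
  a_pos : 0 < a
  b_pos : 0 < b
  coprime : Nat.Coprime a b
  coeff_y : poly.coeff (Finsupp.single 1 a) ≠ 0
  coeff_x : poly.coeff (Finsupp.single 0 b) ≠ 0
  weight_lt : ∀ d ∈ poly.support,
    d = Finsupp.single 1 a ∨ d = Finsupp.single 0 b ∨ a * d 0 + b * d 1 < a * b
  irreducible : Irreducible poly
  nonsingular : ∀ z : Fin 2 → AlgebraicClosure L, MvPolynomial.aeval z poly = 0 →
    ∃ j : Fin 2, MvPolynomial.aeval z (MvPolynomial.pderiv j poly) ≠ 0

namespace CabCurve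

variable {L : Type*} [Field L] {a b : ℕ}

/-- The genus `(a-1)(b-1)/2`. -/
def genus (_X : CabCurve L a b) : ℕ := (a - 1) * (b - 1) / 2

/-- The affine coordinate ring. -/
noncomputable abbrev CoordRing (X : CabCurve L a b) : Type _ :=
  MvPolynomial (Fin 2) L ⧸ Ideal.span {X.poly}

instance isDomain_coordRing (X : CabCurve L a b) : IsDomain X.CoordRing := by
  have hp : Prime X.poly := X.irreducible.prime
  have : (Ideal.span {X.poly}).IsPrime := (Ideal.span_singleton_prime hp.ne_zero).2 hp
  exact Ideal.Quotient.isDomain _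

/-- The function field. -/
noncomputable abbrev FunField (X : CabCurve L a b) : Type _ := FractionRing X.CoordRing

/-- The coordinate function `x`. -/
noncomputable def x (X : CabCurve L a b) : X.FunField :=
  algebraMap X.CoordRing X.FunField (Ideal.Quotient.mk _ (MvPolynomial.X 0))

/-- The coordinate function `y`. -/
noncomputable def y (X : CabCurve L a b) : X.FunField :=
  algebraMap X.CoordRing X.FunField (Ideal.Quotient.mk _ (MvPolynomial.X 1))

/-- A place is at infinity if it does not lie on the affine model. There is exactly one such
place. -/
def IsAtInfinity (X : CabCurve L a b) (P : Place L X.FunField) : Prop :=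
  ¬ (X.x ∈ P.ring ∧ X.y ∈ P.ring)

/-- `x^β y^α` with `α ≤ a - 1` is the leading monomial of `g`: up to a nonzero scalar, `g` is
`x^β y^α` plus a combination of monomials `x^i y^j`, `j ≤ a - 1`, of smaller weighted degree
`ai + bj`. Every nonzero function regular on the affine model has exactly one. -/
def IsLeadingMonomial (X : CabCurve L a b) (g : X.FunField) (β α : ℕ) : Prop :=
  α < a ∧ ∃ c : L, c ≠ 0 ∧ g - c • (X.x ^ β * X.y ^ α) ∈
    Submodule.span L {f | ∃ i j : ℕ, j < a ∧ a * i + b * j < a * β + b * α ∧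
      f = X.x ^ i * X.y ^ j}

/-- `g` has weighted degree `d`. -/
def HasWeightedDegree (X : CabCurve L a b) (g : X.FunField) (d : ℤ) : Prop :=
  ∃ β α : ℕ, X.IsLeadingMonomial g β α ∧ ((a * β + b * α : ℕ) : ℤ) = d

/-- The space `𝓡(g)` of remainders modulo `g`: for the leading monomial `x^β y^α` of `g`, the span
of the `x^u y^v` with `u ≤ β + b - 1`, `v ≤ a - 1` and not both `u ≥ β` and `v ≥ α`. -/
noncomputable def remainders (X : CabCurve L a b) (g : X.FunField) : Submodule L X.FunField :=
  Submodule.span L {f | ∃ β α u v : ℕ, X.IsLeadingMonomial g β α ∧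
    u < β + b ∧ v < a ∧ ¬ (β ≤ u ∧ α ≤ v) ∧ f = X.x ^ u * X.y ^ v}

/-- The code `C_𝓛(𝒳, Pts, sP∞ + (g))`. -/
noncomputable def onePointCode (X : CabCurve L a b) (Pinf : Place L X.FunField)
    (Pts : Finset (Place L X.FunField)) (s : ℤ) (g : X.FunField) : Submodule L (Pts → L) :=
  agCode Pts (Pinf.divisor s + principalDivisor L g)

/-- The one-point Goppa-like code `Γ(Pts, sP∞, g)` over `K`. -/
noncomputable def goppaLike (K : Type*) [Field K] [Algebra K L] (X : CabCurve L a b)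
    (Pinf : Place L X.FunField) (Pts : Finset (Place L X.FunField)) (s : ℤ) (g : X.FunField) :
    Submodule K (Pts → K) :=
  subfieldSubcode K (dualCode (X.onePointCode Pinf Pts s g))

/-- The functions `h` whose multiples `g^{-(q^i+1)} h` enter the trace code `𝓣_i(s, g)`:
`𝓛(2sP∞)` for `i = 0`, and `𝓡(g^{q^i-q^{i-1}+1}) ∩ 𝓛(s(q^i+1)P∞)` for `i ≥ 1`. -/
noncomputable def numerators (X : CabCurve L a b) (Pinf : Place L X.FunField) (q : ℕ)
    (s : ℤ) (g : X.FunField) : ℕ → Submodule L X.FunField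
  | 0 => riemannRoch (Pinf.divisor (2 * s))
  | i + 1 => X.remainders (g ^ (q ^ (i + 1) - q ^ i + 1)) ⊓
      riemannRoch (Pinf.divisor (s * (q ^ (i + 1) + 1)))

/-- The trace code `𝓣_i(s, g)` over `K`, with `q = |K|`. -/
noncomputable def traceT (K : Type*) [Field K] [Algebra K L] (X : CabCurve L a b)
    (Pinf : Place L X.FunField) (Pts : Finset (Place L X.FunField)) (s : ℤ) (g : X.FunField)
    (i : ℕ) : Submodule K (Pts → K) :=
  traceCode K (evalCode Pts ((X.numerators Pinf (Nat.card K) s g i).map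
    (LinearMap.mulLeft L (g ^ (Nat.card K ^ i + 1))⁻¹)))

end CabCurve

/-! Let γ be the genus and F_i = Tr(g^{-(q^i+1)} 𝓛(s(q^i+1)P∞)). By Delsarte, Γ^⊥ lies in Tr(𝒞), and
Tr(c)Tr(d) = ∑_{i<m} Tr(c d^{q^i}). Applying a power of Frobenius inside the trace exchanges the
indices i and m - i together with c and d, so the indices i ≤ m/2 suffice
(`schurProduct_traceCode_le`). An index beyond e costs at most mk², and half of that when 2i = m;
this is the first term of both bounds.

For i ≤ e the products lie in F_i, and F_i ⊆ 𝓣_i (`fullTrace_le_traceT`). For i ≥ 1 divide the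
numerator: f = r + g^{q^i-q^{i-1}+1} w. The second part evaluates to g^{-q^{i-1}} w, which has the
same trace as its q-th power g^{-(q^i+1)} (g w^q). Since s < s', the numerator g w^q has smaller
degree than the bound for f, and descent leaves only remainders.

For the second bound, division by g itself and the same Frobenius step give F_i ⊆ F_{i+1} as soon as
the remainder, of degree at most s' + 2γ - 1, fits into the next space (`fullTrace_le_succ`). That
is the condition on i, and it persists for larger i. The sum therefore collapses to 𝓣_e + ∑_{i<i*}
𝓣_i, and dim 𝓡(h) ≤ deg h bounds 𝓣_e when e ≥ 1. For e = 0 there is no remainder space; three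
estimates compete and `le_bound_of_dichotomy` shows that one of them always suffices.

The geometry rests on two facts. The monomials x^i y^j with j < a have distinct pole orders ai + bj
at P∞, so pole orders are read off leading monomials; and nonsingularity makes the affine curve
normal. Together they identify 𝓛(nP∞) with the span of the monomials of weight at most n
(`riemannRoch_divisor_eq`). -/

/-! ### Duality of codes and sums of subspaces -/

section LinearCodes

theorem dualCode_dualCode {k ι : Type*} [Field k] [Fintype ι] (C : Submodule k (ι → k)) :
    dualCode (dualCode C) = C := by
  have hrefl : LinearMap.BilinForm.IsRefl (dotProductBilin k k : LinearMap.BilinForm k (ι → k)) :=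
    fun x y h => by simpa [dotProduct_comm] using h
  have hnd : LinearMap.BilinForm.Nondegenerate
      (dotProductBilin k k : LinearMap.BilinForm k (ι → k)) := by
    refine hrefl.nondegenerate_iff_separatingLeft.2 fun x hx => ?_
    exact dotProduct_eq_zero _ fun y => by simpa using hx y
  have h : ∀ D : Submodule k (ι → k), dualCode D =
      LinearMap.BilinForm.orthogonal (dotProductBilin k k : LinearMap.BilinForm k (ι → k)) D :=
    fun D => by ext; rfl
  rw [h, h]
  exact LinearMap.BilinForm.orthogonal_orthogonal hnd hrefl C

theorem dualCode_anti {k ι : Type*} [Field k] [Fintype ι] {C D : Submodule k (ι → k)}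
    (h : C ≤ D) : dualCode D ≤ dualCode C := fun _ hx c hc => hx c (h hc)

theorem schurProduct_mono {k ι : Type*} [Field k] {C C' D D' : Submodule k (ι → k)}
    (h : C ≤ C') (h' : D ≤ D') : schurProduct C D ≤ schurProduct C' D' :=
  Submodule.span_mono fun _ ⟨c, hc, d, hd, e⟩ => ⟨c, h hc, d, h' hd, e⟩

/-- The easy half of Delsarte's theorem, dualized. -/
theorem dualCode_subfieldSubcode_dualCode_le {K L ι : Type*} [Field K] [Field L] [Algebra K L]
    [FiniteDimensional K L] [Algebra.IsSeparable K L] [Fintype ι] (C : Submodule L (ι → L)) :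
    dualCode (subfieldSubcode K (dualCode C)) ≤ traceCode K C := by
  rw [← dualCode_dualCode (traceCode K C)]
  apply dualCode_anti
  intro x hx c hc
  -- `C` is stable under all scalars of `L`, so orthogonality to the trace code kills Tr(l⟨c, x⟩)
  -- for every l; nondegeneracy of the trace form then gives ⟨c, x⟩ = 0.
  have key : ∀ l : L, Algebra.trace K L (l * (c ⬝ᵥ fun i => algebraMap K L (x i))) = 0 := by
    intro l
    have h1 := hx _ ⟨l • c, C.smul_mem l hc, rfl⟩
    rw [← h1]
    simp only [dotProduct, Finset.mul_sum, map_sum]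
    refine Finset.sum_congr rfl fun i _ => ?_
    have : l * (c i * algebraMap K L (x i)) = x i • (l * c i) := by
      rw [Algebra.smul_def]; ring
    rw [this, map_smul, smul_eq_mul, mul_comm]
    rfl
  have h0 := (traceForm_nondegenerate K L).1 (c ⬝ᵥ fun i => algebraMap K L (x i))
    (fun n => by rw [Algebra.traceForm_apply, mul_comm]; exact key n)
  exact h0

theorem le_sum_of_mem {R M : Type*} [Semiring R] [AddCommMonoid M] [Module R M]
    {S : ℕ → Submodule R M} {s : Finset ℕ} {i : ℕ} (hi : i ∈ s) : S i ≤ ∑ j ∈ s, S j := by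
  rw [← Finset.add_sum_erase _ _ hi, Submodule.add_eq_sup]
  exact le_sup_left

theorem sum_le_of_forall_le {R M : Type*} [Semiring R] [AddCommMonoid M] [Module R M]
    {S : ℕ → Submodule R M} {s : Finset ℕ} {T : Submodule R M} (h : ∀ i ∈ s, S i ≤ T) :
    ∑ j ∈ s, S j ≤ T := by
  classical
  induction s using Finset.induction_on with
  | empty => simp
  | insert i s hi ih =>
    rw [Finset.sum_insert hi, Submodule.add_eq_sup]
    exact sup_le (h i (Finset.mem_insert_self _ _))
      (ih fun j hj => h j (Finset.mem_insert_of_mem hj))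

theorem finrank_sum_le_sum_finrank {R M : Type*} [Field R] [AddCommGroup M] [Module R M]
    [FiniteDimensional R M] (S : ℕ → Submodule R M) (s : Finset ℕ) :
    Module.finrank R (∑ j ∈ s, S j : Submodule R M) ≤ ∑ j ∈ s, Module.finrank R (S j) := by
  classical
  induction s using Finset.induction_on with
  | empty => exact (finrank_bot R M).le
  | insert i s hi ih =>
    rw [Finset.sum_insert hi, Finset.sum_insert hi, Submodule.add_eq_sup]
    exact (Submodule.finrank_add_le_finrank_add_finrank _ _).trans (by lia)

end LinearCodes

/-! ### Products of traces and the dimensions of their spans -/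

section TraceProducts

variable {K L ι : Type*} [Field K] [Finite K] [Field L] [Finite L] [Algebra K L]

theorem trace_pow_card_pow (x : L) (i : ℕ) :
    Algebra.trace K L (x ^ Nat.card K ^ i) = Algebra.trace K L x := by
  have := Fintype.ofFinite K
  have h := Algebra.trace_eq_of_algEquiv (FiniteField.frobeniusAlgEquivOfAlgebraic K L ^ i) x
  rwa [AlgEquiv.coe_pow, FiniteField.coe_frobeniusAlgEquivOfAlgebraic_iterate,
    ← Nat.card_eq_fintype_card] at h

variable (K) in
/-- The componentwise trace. -/
noncomputable def traceVec : (ι → L) →ₗ[K] (ι → K) := (Algebra.trace K L).compLeft ι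

theorem traceVec_pow_card_pow (c : ι → L) (i : ℕ) :
    traceVec K (c ^ Nat.card K ^ i) = traceVec K c :=
  funext fun _ => trace_pow_card_pow _ _

theorem pow_card_pow_finrank (c : ι → L) : c ^ Nat.card K ^ Module.finrank K L = c := by
  have := Fintype.ofFinite K
  have := Fintype.ofFinite L
  funext P
  rw [Pi.pow_apply, Nat.card_eq_fintype_card, ← Module.card_eq_pow_finrank, FiniteField.pow_card]

omit [Finite K] in
theorem traceVec_mul_traceVec (c d : ι → L) :
    traceVec K c * traceVec K d =
      ∑ i ∈ Finset.range (Module.finrank K L), traceVec K (c * d ^ Nat.card K ^ i) := by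
  funext P
  rw [← map_sum, ← Finset.mul_sum]
  change Algebra.trace K L (c P) * Algebra.trace K L (d P) = Algebra.trace K L _
  -- The sum of the Frobenius conjugates of `d P` is its trace, a scalar of `K` that passes through
  -- the outer trace.
  have : (c * ∑ i ∈ Finset.range (Module.finrank K L), d ^ Nat.card K ^ i) P =
      Algebra.trace K L (d P) • c P := by
    rw [Algebra.smul_def, FiniteField.algebraMap_trace_eq_sum_pow]
    simp [mul_comm]
  rw [this, map_smul, smul_eq_mul, mul_comm]

variable (K) in
/-- The span of the traces of `c * d ^ (q ^ i)` with `c, d ∈ C`. -/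
noncomputable def twistedSquare (C : Submodule L (ι → L)) (i : ℕ) : Submodule K (ι → K) :=
  Submodule.span K {x | ∃ c ∈ C, ∃ d ∈ C, x = traceVec K (c * d ^ Nat.card K ^ i)}

/-- The Frobenius power q^{m-i} preserves the trace and turns c d^{q^i} into d c^{q^{m-i}}, because
d^{q^m} = d. This folds the indices above m/2 onto those below. -/
theorem traceVec_mul_pow_mem_twistedSquare {C : Submodule L (ι → L)} {c d : ι → L} (hc : c ∈ C)
    (hd : d ∈ C) {i : ℕ} (hi : i ≤ Module.finrank K L) :
    traceVec K (c * d ^ Nat.card K ^ i) ∈ twistedSquare K C (Module.finrank K L - i) := by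
  refine Submodule.subset_span ⟨d, hd, c, hc, ?_⟩
  rw [← traceVec_pow_card_pow _ (Module.finrank K L - i), mul_pow, ← pow_mul, ← pow_add,
    Nat.add_sub_cancel' hi, pow_card_pow_finrank, mul_comm]

theorem schurProduct_traceCode_le (C : Submodule L (ι → L)) :
    schurProduct (traceCode K C) (traceCode K C) ≤
      ∑ i ∈ Finset.range (Module.finrank K L / 2 + 1), twistedSquare K C i := by
  refine Submodule.span_le.2 ?_
  rintro _ ⟨_, ⟨c, hc, rfl⟩, _, ⟨d, hd, rfl⟩, rfl⟩
  change traceVec K c * traceVec K d ∈ _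
  rw [traceVec_mul_traceVec]
  refine Submodule.sum_mem _ fun i hi => ?_
  rw [Finset.mem_range] at hi
  rcases le_or_gt i (Module.finrank K L / 2) with h | h
  · exact le_sum_of_mem (Finset.mem_range.2 (by lia))
      (Submodule.subset_span ⟨c, hc, d, hd, rfl⟩)
  · exact le_sum_of_mem (S := twistedSquare K C) (i := Module.finrank K L - i)
      (Finset.mem_range.2 (by lia)) (traceVec_mul_pow_mem_twistedSquare hc hd hi.le)

variable [Finite ι]

/-- The `K`-linear map `Λ ↦ Tr (∑ Λ_{rs} b_r b_s ^ (q ^ i))`. -/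
noncomputable def twistedSquareMap {n : Type*} [Fintype n] (b : n → ι → L) (i : ℕ) :
    (n → n → L) →ₗ[K] (ι → K) where
  toFun Λ := traceVec K (∑ r, ∑ s, Λ r s • (b r * b s ^ Nat.card K ^ i))
  map_add' Λ M := by
    simp only [Pi.add_apply, add_smul, Finset.sum_add_distrib, map_add]
  map_smul' x Λ := by
    simp only [Pi.smul_apply, RingHom.id_apply, ← map_smul, Finset.smul_sum, smul_assoc]

omit [Finite L] [Finite ι] in
-- In coordinates, Frobenius being additive, c d^{q^i} is the value of the map at a matrix of rank
-- at most one; so the dimension is at most that of the space of k × k matrices over `L`.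
theorem twistedSquare_le_range (C : Submodule L (ι → L)) {n : Type*} [Fintype n]
    (b : Module.Basis n L C) (i : ℕ) :
    twistedSquare K C i ≤
      LinearMap.range (twistedSquareMap (K := K) (fun r => (b r : ι → L)) i) := by
  refine Submodule.span_le.2 ?_
  rintro _ ⟨c, hc, d, hd, rfl⟩
  refine ⟨fun r s => b.repr ⟨c, hc⟩ r * (b.repr ⟨d, hd⟩ s) ^ Nat.card K ^ i, ?_⟩
  have hc' : c = ∑ r, b.repr ⟨c, hc⟩ r • (b r : ι → L) := by
    have := congrArg (Submodule.subtype C) (b.sum_repr ⟨c, hc⟩)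
    rw [map_sum] at this
    exact this.symm
  have hd' : d = ∑ r, b.repr ⟨d, hd⟩ r • (b r : ι → L) := by
    have := congrArg (Submodule.subtype C) (b.sum_repr ⟨d, hd⟩)
    rw [map_sum] at this
    exact this.symm
  have hpow : d ^ Nat.card K ^ i =
      ∑ s, (b.repr ⟨d, hd⟩ s) ^ Nat.card K ^ i • (b s : ι → L) ^ Nat.card K ^ i := by
    have := Fintype.ofFinite K
    funext P
    conv_lhs => rw [hd']
    simp only [Pi.pow_apply, Finset.sum_apply, Pi.smul_apply, smul_eq_mul]
    have h := map_sum ((FiniteField.frobeniusAlgHom K L) ^ i)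
      (fun r => b.repr ⟨d, hd⟩ r * (b r : ι → L) P) Finset.univ
    rw [AlgHom.coe_pow, FiniteField.coe_frobeniusAlgHom, pow_iterate,
      ← Nat.card_eq_fintype_card] at h
    simp only [mul_pow] at h
    exact h
  change traceVec K _ = _
  congr 1
  rw [hpow]
  conv_rhs => rw [hc']
  rw [Finset.sum_mul_sum]
  refine Finset.sum_congr rfl fun r _ => Finset.sum_congr rfl fun s _ => ?_
  rw [smul_mul_smul_comm]

theorem finrank_twistedSquare_le (C : Submodule L (ι → L)) (i : ℕ) :
    Module.finrank K (twistedSquare K C i) ≤ Module.finrank K L * Module.finrank L C ^ 2 := by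
  refine (Submodule.finrank_mono (twistedSquare_le_range C (Module.finBasis L C) i)).trans ?_
  refine (LinearMap.finrank_range_le _).trans (le_of_eq ?_)
  simp only [Module.finrank_pi_fintype, Finset.sum_const, Finset.card_univ, Fintype.card_fin,
    smul_eq_mul]
  ring

/-- For 2i = m the map σ : x ↦ x^{q^i} is an involution, and Ψ takes the same value at Λ and at τΛ =
σ(Λᵀ). Hence the rank of Ψ is at most the dimension of the fixed space of τ, the Hermitian matrices.
Multiplying that space by an l with σ(l) ≠ l gives a complementary copy meeting it in 0, so it fills
at most half of the mk² dimensions. -/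
theorem two_mul_finrank_twistedSquare_le (C : Submodule L (ι → L)) {i : ℕ} (hi : 0 < i)
    (him : 2 * i = Module.finrank K L) :
    2 * Module.finrank K (twistedSquare K C i) ≤
      Module.finrank K L * Module.finrank L C ^ 2 := by
  have := Fintype.ofFinite K
  set b := Module.finBasis L C
  set Ψ := twistedSquareMap (K := K) (fun r => (b r : ι → L)) i with hΨ
  have h1 := Submodule.finrank_mono (twistedSquare_le_range (K := K) C b i)
  rw [← hΨ] at h1
  have h2 := LinearMap.finrank_range_add_finrank_ker Ψ
  set σ := (FiniteField.frobeniusAlgEquivOfAlgebraic K L) ^ i with hσ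
  have hσa : ∀ x, σ x = x ^ Nat.card K ^ i := fun x => by
    rw [hσ, AlgEquiv.coe_pow, FiniteField.coe_frobeniusAlgEquivOfAlgebraic_iterate,
      ← Nat.card_eq_fintype_card]
  have hσ1 : σ ≠ 1 := by
    intro h
    have := orderOf_dvd_of_pow_eq_one h
    rw [FiniteField.orderOf_frobeniusAlgEquivOfAlgebraic, ← him] at this
    have := Nat.le_of_dvd hi this
    lia
  obtain ⟨l, hl⟩ : ∃ l, σ l ≠ l := by
    by_contra! h
    exact hσ1 (AlgEquiv.ext h)
  let τ : (Fin (Module.finrank L C) → Fin (Module.finrank L C) → L) →ₗ[K]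
      (Fin (Module.finrank L C) → Fin (Module.finrank L C) → L) :=
    { toFun := fun Λ r s => σ (Λ s r)
      map_add' := fun _ _ => by funext r s; simp
      map_smul' := fun _ _ => by funext r s; simp }
  have hτ : ∀ Λ r s, τ Λ r s = σ (Λ s r) := fun _ _ _ => rfl
  have hσσ : ∀ x, σ (σ x) = x := fun x => by
    have h := congrFun (pow_card_pow_finrank (K := K) (fun _ : Unit => x)) ()
    rw [hσa, hσa, ← pow_mul, ← pow_add, ← two_mul, him]
    exact h
  have hΨτ : ∀ Λ, Ψ (τ Λ) = Ψ Λ := by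
    intro Λ
    change traceVec K _ = traceVec K _
    simp only [map_sum]
    rw [Finset.sum_comm]
    refine Finset.sum_congr rfl fun r _ => Finset.sum_congr rfl fun s _ => ?_
    rw [← traceVec_pow_card_pow _ i]
    congr 1
    funext P
    have := hσσ (b r |>.1 P)
    simp only [hσa] at this
    simp only [hτ, Pi.pow_apply, Pi.smul_apply, Pi.mul_apply, smul_eq_mul, mul_pow, this]
    rw [← hσa, hσσ]; ring
  have h3 : LinearMap.range (LinearMap.id - τ) ≤ LinearMap.ker Ψ := by
    rintro _ ⟨Λ, rfl⟩
    simp [hΨτ]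
  have h4 := Submodule.finrank_mono h3
  have h5 := LinearMap.finrank_range_add_finrank_ker (LinearMap.id - τ)
  set F := LinearMap.ker (LinearMap.id - τ) with hF
  have hFm : ∀ Λ ∈ F, τ Λ = Λ := fun Λ hΛ => by
    have : Λ - τ Λ = 0 := hΛ
    exact (sub_eq_zero.1 this).symm
  let M : (Fin (Module.finrank L C) → Fin (Module.finrank L C) → L) →ₗ[K]
      (Fin (Module.finrank L C) → Fin (Module.finrank L C) → L) :=
    { toFun := fun Λ => l • Λ
      map_add' := fun _ _ => smul_add _ _ _
      map_smul' := fun _ _ => by rw [RingHom.id_apply, smul_comm] }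
  have hl0 : l ≠ 0 := fun h => hl (by rw [h, map_zero])
  have hM : Function.Injective M := fun x y h => smul_right_injective _ hl0 h
  have hdisj : F ⊓ F.map M = ⊥ := by
    rw [eq_bot_iff]
    rintro _ ⟨hx, Λ, hΛ, rfl⟩
    have e1 := hFm _ hx
    have e2 := hFm _ hΛ
    have : Λ = 0 := by
      funext r s
      have e3 := congrFun (congrFun e1 r) s
      have e4 := congrFun (congrFun e2 r) s
      change σ (l * Λ s r) = l * Λ r s at e3
      change σ (Λ s r) = Λ r s at e4
      rw [map_mul, e4] at e3
      by_contra h0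
      exact hl (mul_right_cancel₀ h0 e3)
    rw [this]; simp
  have h6 := Submodule.finrank_sup_add_finrank_inf_eq F (F.map M)
  rw [hdisj, finrank_bot, (Submodule.equivMapOfInjective M hM F).finrank_eq.symm] at h6
  have h7 := Submodule.finrank_le (F ⊔ F.map M)
  have h8 : Module.finrank K (Fin (Module.finrank L C) → Fin (Module.finrank L C) → L) =
      Module.finrank K L * Module.finrank L C ^ 2 := by
    simp only [Module.finrank_pi_fintype, Finset.sum_const, Finset.card_univ, Fintype.card_fin,
      smul_eq_mul]
    ring
  rw [h8] at h2 h5 h7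
  clear_value F Ψ
  linarith

/-- The dimension bound for the square of a trace code, in terms of any submodules `S i`, `i ≤ e`,
that contain the traces of `c * d ^ (q ^ i)`. -/
theorem finrank_schurProduct_traceCode_le (C : Submodule L (ι → L)) (S : ℕ → Submodule K (ι → K))
    {e : ℕ} (he : e ≤ Module.finrank K L / 2) (hS : ∀ i ≤ e, twistedSquare K C i ≤ S i) :
    (Module.finrank K (schurProduct (traceCode K C) (traceCode K C)) : ℚ) ≤
      max (((Module.finrank K L : ℚ) - 1) / 2 - e) 0 * Module.finrank K L *
        (Module.finrank L C : ℚ) ^ 2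
      + Module.finrank K (∑ i ∈ Finset.range (e + 1), S i : Submodule K (ι → K)) := by
  have hm0 : 0 < Module.finrank K L := Module.finrank_pos
  set m := Module.finrank K L with hm
  set k := Module.finrank L C with hk
  have h1 : schurProduct (traceCode K C) (traceCode K C) ≤
      (∑ i ∈ Finset.range (e + 1), S i) + ∑ i ∈ Finset.Ico (e + 1) (m / 2 + 1),
        twistedSquare K C i := by
    refine (schurProduct_traceCode_le C).trans ?_
    rw [Finset.range_eq_Ico, ← Finset.sum_Ico_consecutive _ (Nat.zero_le (e + 1)) (by lia),
      Submodule.add_eq_sup, Submodule.add_eq_sup]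
    refine sup_le_sup_right (sum_le_of_forall_le fun i hi => ?_) _
    rw [← Finset.range_eq_Ico] at hi
    exact (hS i (by simp at hi; lia)).trans (le_sum_of_mem (S := S) hi)
  have h2 := Submodule.finrank_mono h1
  rw [Submodule.add_eq_sup] at h2
  have h3 := h2.trans (Submodule.finrank_add_le_finrank_add_finrank _ _)
  have h4 := h3.trans (Nat.add_le_add_left (finrank_sum_le_sum_finrank _ _) _)
  suffices h5 : ((∑ i ∈ Finset.Ico (e + 1) (m / 2 + 1),
      Module.finrank K (twistedSquare K C i) : ℕ) : ℚ) ≤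
      max (((m : ℚ) - 1) / 2 - e) 0 * m * (k : ℚ) ^ 2 by
    have h4' : (Module.finrank K (schurProduct (traceCode K C) (traceCode K C)) : ℚ) ≤ _ :=
      Nat.cast_le.2 h4
    push_cast at h4' h5 ⊢
    linarith
  have hk2 : (0 : ℚ) ≤ m * (k : ℚ) ^ 2 := by positivity
  have hmul : ∀ u, ((m : ℚ) - 1) / 2 - e = u → u * (m * (k : ℚ) ^ 2) ≤
      max (((m : ℚ) - 1) / 2 - e) 0 * m * (k : ℚ) ^ 2 := by
    rintro _ rfl
    rw [mul_assoc]
    exact mul_le_mul_of_nonneg_right (le_max_left _ _) hk2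
  have hbound : ∀ t, ((∑ i ∈ Finset.Ico (e + 1) (e + 1 + t),
      Module.finrank K (twistedSquare K C i) : ℕ) : ℚ) ≤ t * (m * (k : ℚ) ^ 2) := by
    intro t
    have : ∑ i ∈ Finset.Ico (e + 1) (e + 1 + t), Module.finrank K (twistedSquare K C i) ≤
        ∑ i ∈ Finset.Ico (e + 1) (e + 1 + t), m * k ^ 2 :=
      Finset.sum_le_sum fun i _ => finrank_twistedSquare_le C i
    rw [Finset.sum_const, Nat.card_Ico, Nat.add_sub_cancel_left, smul_eq_mul] at this
    exact_mod_cast this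
  -- When e = m/2 nothing is left to sum, but for even m the coefficient (m-1)/2 - e is -1/2; this
  -- is why the maximum with 0 is taken.
  rcases he.eq_or_lt with h | h
  · rw [h]
    simp only [Finset.Ico_self, Finset.sum_empty, Nat.cast_zero]
    positivity
  -- For even m there are t full summands and the half summand i = m/2, for odd m there are t full
  -- ones; both totals equal (m-1)/2 - e.
  rcases Nat.even_or_odd' m with ⟨n, hn | hn⟩
  · obtain ⟨t, ht⟩ : ∃ t, m / 2 = e + 1 + t := ⟨m / 2 - (e + 1), by lia⟩
    rw [ht, Finset.sum_Ico_succ_top (by lia)]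
    have h6 := hbound t
    have h7 := two_mul_finrank_twistedSquare_le (K := K) C (i := e + 1 + t) (by lia) (by lia)
    have h8 : 2 * (Module.finrank K (twistedSquare K C (e + 1 + t)) : ℚ) ≤ m * (k : ℚ) ^ 2 := by
      exact_mod_cast h7
    have hmq : (m : ℚ) = 2 * (e + 1 + t) := by
      have : m = 2 * (e + 1 + t) := by lia
      exact_mod_cast this
    have : (((m : ℚ) - 1) / 2 - e) = t + 1 / 2 := by rw [hmq]; ring
    have h9 := hmul _ this
    rw [add_mul] at h9
    push_cast at h6 ⊢
    linarith
  · obtain ⟨t, ht⟩ : ∃ t, m / 2 + 1 = e + 1 + t := ⟨m / 2 - e, by lia⟩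
    rw [ht]
    have hmq : (m : ℚ) = 2 * (e + t) + 1 := by
      have : m = 2 * (e + t) + 1 := by lia
      exact_mod_cast this
    have : (((m : ℚ) - 1) / 2 - e) = t := by rw [hmq]; ring
    exact (hbound t).trans (hmul _ this)

omit [Finite K] in
theorem finrank_traceCode_le (C : Submodule L (ι → L)) :
    Module.finrank K (traceCode K C) ≤ Module.finrank K L * Module.finrank L C := by
  refine (Submodule.finrank_map_le _ _).trans ?_
  rw [Module.finrank_mul_finrank K L C]
  exact le_rfl

end TraceProducts

/-! ### Places, valuations and values -/

namespace Place

variable {k F : Type*} [Field k] [Field F] [Algebra k F]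

theorem mem_ring_iff (P : Place k F) {f : F} : f ∈ P.ring ↔ P.val f ≤ 1 := by
  have := P.isDVR
  constructor
  · intro hf
    exact (IsDiscreteValuationRing.maximalIdeal P.ring).valuation_le_one (K := F)
      (⟨f, hf⟩ : P.ring)
  · intro hf
    obtain ⟨r, hr⟩ := IsDiscreteValuationRing.exists_lift_of_le_one (A := P.ring) (K := F) hf
    rw [← hr]
    exact r.2

theorem exists_val_eq_exp_neg_one (P : Place k F) : ∃ π : F, P.val π = WithZero.exp (-1 : ℤ) :=
  haveI := P.isDVR
  (IsDiscreteValuationRing.maximalIdeal P.ring).valuation_exists_uniformizer F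

theorem ext_ring {P Q : Place k F} (h : P.ring = Q.ring) : P = Q := by
  cases P; cases Q; cases h; rfl

theorem ring_ne_top (P : Place k F) : P.ring ≠ ⊤ := by
  intro h
  obtain ⟨π, hπ⟩ := P.exists_val_eq_exp_neg_one
  have h1 : P.val π⁻¹ ≤ 1 := P.mem_ring_iff.1 (h ▸ ValuationSubring.mem_top _)
  rw [map_inv₀, hπ, ← WithZero.exp_neg, ← WithZero.exp_zero, WithZero.exp_le_exp] at h1
  lia

/-- A discrete valuation ring has dimension one, so the only rings strictly above it is the whole
field, and that is not a place. -/
theorem eq_of_ring_le {P Q : Place k F} (h : P.ring ≤ Q.ring) : P = Q := by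
  have := P.isDVR
  have : Ring.KrullDimLE 1 P.ring := 
    Ring.KrullDimLE.mk₁' fun _ a _ => IsPrime.to_maximal_ideal a
  exact ext_ring (ValuationSubring.eq_of_le_of_ne_top _ h Q.ring_ne_top)

theorem val_algebraMap (P : Place k F) {c : k} (hc : c ≠ 0) : P.val (algebraMap k F c) = 1 := by
  refine le_antisymm (P.val_algebraMap_le_one c) ?_
  have h := P.val_algebraMap_le_one c⁻¹
  rw [map_inv₀, map_inv₀] at h
  have h0 : P.val (algebraMap k F c) ≠ 0 := by simpa using hc
  exact (inv_le_one₀ (zero_lt_iff.2 h0)).1 h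

theorem val_smul (P : Place k F) {c : k} (hc : c ≠ 0) (f : F) : P.val (c • f) = P.val f := by
  rw [Algebra.smul_def, map_mul, P.val_algebraMap hc, one_mul]

theorem val_smul_le (P : Place k F) (c : k) (f : F) : P.val (c • f) ≤ P.val f := by
  rw [Algebra.smul_def, map_mul]
  exact mul_le_of_le_one_left' (P.val_algebraMap_le_one c)

theorem val_eq_exp_neg_ord (P : Place k F) {f : F} (hf : f ≠ 0) :
    P.val f = WithZero.exp (-P.ord f) := by
  rw [ord, neg_neg, WithZero.exp_log (by simpa using hf)]

/-- The functions of valuation at most `γ`. -/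
def valLE (P : Place k F) (γ : ℤᵐ⁰) : Submodule k F where
  carrier := {f | P.val f ≤ γ}
  add_mem' hf hg := (P.val.map_add _ _).trans (max_le hf hg)
  zero_mem' := by simp
  smul_mem' c f hf := (P.val_smul_le c f).trans hf

namespace HasValue

variable {P : Place k F} {f g : F} {c d : k}

theorem val_le_one (h : P.HasValue f c) : P.val f ≤ 1 := by
  have : f = (f - algebraMap k F c) + algebraMap k F c := by ring
  rw [this]
  exact (P.val.map_add _ _).trans (max_le (le_of_lt h) (P.val_algebraMap_le_one c))

theorem unique (h : P.HasValue f c) (h' : P.HasValue f d) : c = d := by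
  by_contra hcd
  have h1 : P.val (algebraMap k F (c - d)) < 1 := by
    have : algebraMap k F (c - d) = (f - algebraMap k F d) - (f - algebraMap k F c) := by
      rw [map_sub]; ring
    rw [this]
    exact P.val.map_sub_lt h' h
  rw [P.val_algebraMap (sub_ne_zero.2 hcd)] at h1
  exact lt_irrefl _ h1

theorem const (P : Place k F) (c : k) : P.HasValue (algebraMap k F c) c := by simp [HasValue]

theorem zero (P : Place k F) : P.HasValue 0 (0 : k) := by simp [HasValue]

theorem one (P : Place k F) : P.HasValue 1 (1 : k) := by simp [HasValue]

theorem add (h : P.HasValue f c) (h' : P.HasValue g d) : P.HasValue (f + g) (c + d) := by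
  have e : f + g - algebraMap k F (c + d) = (f - algebraMap k F c) + (g - algebraMap k F d) := by
    rw [map_add]; ring
  rw [HasValue, e]
  exact P.val.map_add_lt h h'

theorem mul (h : P.HasValue f c) (h' : P.HasValue g d) : P.HasValue (f * g) (c * d) := by
  have e : f * g - algebraMap k F (c * d) =
      (f - algebraMap k F c) * g + algebraMap k F c * (g - algebraMap k F d) := by
    rw [map_mul]; ring
  rw [HasValue, e]
  refine P.val.map_add_lt ?_ ?_
  · rw [map_mul]
    exact mul_lt_of_lt_of_le_one h h'.val_le_one
  · rw [map_mul]
    exact mul_lt_of_le_one_of_lt (P.val_algebraMap_le_one c) h'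

theorem pow (h : P.HasValue f c) (n : ℕ) : P.HasValue (f ^ n) (c ^ n) := by
  induction n with
  | zero => simpa using one P
  | succ n ih => rw [pow_succ, pow_succ]; exact ih.mul h

theorem eq_zero_iff (h : P.HasValue f c) : c = 0 ↔ P.val f < 1 := by
  constructor
  · rintro rfl
    simpa [HasValue] using h
  · intro hf
    exact h.unique (by simpa [HasValue] using hf)

end HasValue

theorem IsRational.exists_hasValue {P : Place k F} (hP : P.IsRational) {f : F}
    (hf : P.val f ≤ 1) : ∃ c, P.HasValue f c := hP f (P.mem_ring_iff.2 hf)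

end Place

/-! ### Local rings at nonsingular points -/

section Jacobian

open Polynomial in
/-- At a point `(z₀, z₁)` of a plane curve `f = 0` with `∂f/∂Y ≠ 0`, the polynomial `minpoly z₀`
generates the maximal ideal of the local ring. -/
theorem exists_minpoly_generates {L Ω : Type*} [Field L] [Field Ω] [Algebra L Ω]
    [Algebra.IsAlgebraic L Ω] (z₀ z₁ : Ω) (f : L[X][X])
    (hf : f.eval₂ (aeval z₀ : L[X] →ₐ[L] Ω).toRingHom z₁ = 0)
    (hf' : (derivative f).eval₂ (aeval z₀ : L[X] →ₐ[L] Ω).toRingHom z₁ ≠ 0) :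
    ∃ p : L[X], aeval z₀ p = 0 ∧
      ∀ h : L[X][X], h.eval₂ (aeval z₀ : L[X] →ₐ[L] Ω).toRingHom z₁ = 0 →
        ∃ B C D : L[X][X], B.eval₂ (aeval z₀ : L[X] →ₐ[L] Ω).toRingHom z₁ ≠ 0 ∧
          B * h = C * f + D * Polynomial.C p := by
  set p := minpoly L z₀ with hp
  have hp0 : aeval z₀ p = 0 := minpoly.aeval L z₀
  have hint : IsIntegral L z₀ := Algebra.IsIntegral.isIntegral z₀
  have : Fact (Irreducible p) := ⟨minpoly.irreducible hint⟩
  let E := AdjoinRoot p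
  have hp0' : p.eval₂ (algebraMap L Ω) z₀ = 0 := hp0
  let φ : E →+* Ω := AdjoinRoot.lift (algebraMap L Ω) z₀ hp0'
  let π : L[X] →+* E := AdjoinRoot.mk p
  have hφπ : φ.comp π = (aeval z₀ : L[X] →ₐ[L] Ω).toRingHom :=
    RingHom.ext fun u => AdjoinRoot.lift_mk hp0' u
  let : Algebra E Ω := φ.toAlgebra
  have halg : algebraMap E Ω = φ := rfl
  have heval : ∀ h : L[X][X], h.eval₂ (aeval z₀ : L[X] →ₐ[L] Ω).toRingHom z₁ =
      aeval z₁ (h.map π) := by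
    intro h
    rw [aeval_def, eval₂_map, halg, hφπ]
  have hker : RingHom.ker (mapRingHom π) = Ideal.span {Polynomial.C p} := by
    rw [ker_mapRingHom, show RingHom.ker π = Ideal.span {p} from Ideal.mk_ker, Ideal.map_span,
      Set.image_singleton]
  have hsurj : Function.Surjective (Polynomial.map π) := map_surjective π AdjoinRoot.mk_surjective
  have : IsScalarTower L E Ω := IsScalarTower.of_algebraMap_eq fun x =>
    (AdjoinRoot.lift_of hp0').symm
  have hint1 : IsIntegral E z₁ := (Algebra.IsIntegral.isIntegral (R := L) z₁).tower_top
  -- Modulo p, f is a polynomial over `E` = L(z₀) with the root z₁. The root is simple since ∂f/∂Y ≠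
  -- 0, so the cofactor B₀ of the minimal polynomial of z₁ does not vanish there. Any h vanishing at
  -- the point is also a multiple of that minimal polynomial modulo p, hence B h ≡ C f. Separability
  -- of z₀ over `L` plays no role.
  obtain ⟨B₀, hB₀⟩ := minpoly.dvd E z₁ (p := f.map π) (by rw [← heval, hf])
  have hB₀z : aeval z₁ B₀ ≠ 0 := by
    intro h0
    apply hf'
    rw [heval, ← derivative_map, hB₀, derivative_mul, map_add, map_mul, map_mul, h0,
      minpoly.aeval]
    simp
  obtain ⟨B, rfl⟩ := hsurj B₀
  refine ⟨p, hp0, fun h hh => ?_⟩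
  obtain ⟨C₀, hC₀⟩ := minpoly.dvd E z₁ (p := h.map π) (by rw [← heval, hh])
  obtain ⟨C, rfl⟩ := hsurj C₀
  have hmem : B * h - C * f ∈ RingHom.ker (mapRingHom π) := by
    rw [RingHom.mem_ker, map_sub, map_mul, map_mul]
    simp only [coe_mapRingHom]
    rw [hB₀, hC₀]; ring
  rw [hker, Ideal.mem_span_singleton] at hmem
  obtain ⟨D, hD⟩ := hmem
  refine ⟨B, C, D, by rw [heval]; exact hB₀z, ?_⟩
  rw [← sub_eq_iff_eq_add', hD, mul_comm]

open MvPolynomial in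
/-- At a nonsingular point of a plane curve `f = 0`, the maximal ideal of the local ring is
generated by one element. -/
theorem exists_generator_of_pderiv_ne_zero {L Ω : Type*} [Field L] [Field Ω] [Algebra L Ω]
    [Algebra.IsAlgebraic L Ω] (z : Fin 2 → Ω) (f : MvPolynomial (Fin 2) L)
    (hf : aeval z f = 0) (j : Fin 2) (hj : aeval z (pderiv j f) ≠ 0) :
    ∃ p : MvPolynomial (Fin 2) L, aeval z p = 0 ∧
      ∀ h : MvPolynomial (Fin 2) L, aeval z h = 0 →
        ∃ B C D : MvPolynomial (Fin 2) L, aeval z B ≠ 0 ∧ B * h = C * f + D * p := by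
  -- `i` is the other variable; the polynomial ring is read as L[X_i][X_j].
  obtain ⟨i, hij⟩ : ∃ i : Fin 2, ∀ l, l = i ∨ l = j ∧ l ≠ i := by
    fin_cases j
    · exact ⟨1, by decide⟩
    · exact ⟨0, by decide⟩
  have hji : j ≠ i := by
    intro h
    subst h
    have h0 := hij 0
    have h1 := hij 1
    have : (0 : Fin 2) = 1 := by
      rcases h0 with h0 | h0 <;> rcases h1 with h1 | h1
      · rw [h0, h1]
      · exact absurd h1.1 h1.2
      · exact absurd h0.1 h0.2
      · exact absurd h1.1 h1.2
    exact absurd this (by decide)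
  let φ : Polynomial (Polynomial L) →+* MvPolynomial (Fin 2) L :=
    Polynomial.eval₂RingHom (Polynomial.aeval (X i : MvPolynomial (Fin 2) L)).toRingHom (X j)
  let ψ : MvPolynomial (Fin 2) L →ₐ[L] Polynomial (Polynomial L) :=
    aeval fun l => if l = i then Polynomial.C Polynomial.X else Polynomial.X
  have hφψ : ∀ g, φ (ψ g) = g := by
    intro g
    have : (φ.comp ψ.toRingHom) = RingHom.id _ := by
      ext l
      · simp [φ, ψ, Polynomial.algebraMap_apply, MvPolynomial.algebraMap_eq]
      · rcases hij l with rfl | ⟨rfl, hl⟩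
        · simp [φ, ψ]
        · simp [φ, ψ, hl]
    exact RingHom.congr_fun this g
  have heval : ∀ g, g.eval₂ (Polynomial.aeval (z i) : Polynomial L →ₐ[L] Ω).toRingHom (z j) =
      aeval z (φ g) := by
    intro g
    have : Polynomial.eval₂RingHom (Polynomial.aeval (z i) : Polynomial L →ₐ[L] Ω).toRingHom (z j) =
        (aeval z).toRingHom.comp φ := by
      ext <;> simp [φ]
    exact RingHom.congr_fun this g
  have hder : ∀ g, φ (Polynomial.derivative g) = pderiv j (φ g) := by
    intro g
    have hC : ∀ u : Polynomial L, pderiv j (Polynomial.aeval (X i : MvPolynomial (Fin 2) L) u) = 0 := by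
      intro u
      rw [Derivation.map_aeval, pderiv_X_of_ne hji.symm, smul_zero]
    induction g using Polynomial.induction_on' with
    | add p q hp hq => simp only [map_add, hp, hq]
    | monomial n u =>
      have e : ∀ n u, φ (Polynomial.monomial n u) = Polynomial.aeval (X i) u * X j ^ n := by
        intro n u
        simp [φ, Polynomial.eval₂_monomial]
      rw [Polynomial.derivative_monomial, e, e, Derivation.leibniz, hC, Derivation.leibniz_pow,
        pderiv_X_self]
      simp
      ring
  obtain ⟨p, hp, H⟩ := exists_minpoly_generates (z i) (z j) (ψ f) (by rw [heval, hφψ, hf])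
    (by rwa [heval, hder, hφψ])
  refine ⟨φ (Polynomial.C p), ?_, fun h hh => ?_⟩
  · rw [← heval, Polynomial.eval₂_C]; exact hp
  · obtain ⟨B, C, D, hB, e⟩ := H (ψ h) (by rw [heval, hφψ, hh])
    refine ⟨φ B, φ C, φ D, by rwa [← heval], ?_⟩
    have := congrArg φ e
    simpa only [map_mul, map_add, hφψ] using this

end Jacobian

/-- If the maximal ideal of the local ring of a noetherian domain at `I` is principal, then this
local ring is a discrete valuation ring. -/
theorem exists_valuationSubring_of_local_generator {A F : Type*} [CommRing A] [IsDomain A]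
    [IsNoetherianRing A] [Field F] [Algebra A F] [IsFractionRing A F] (I : Ideal A)
    [hI : I.IsMaximal] (hI0 : I ≠ ⊥)
    (hgen : ∃ p ∈ I, ∀ x ∈ I, ∃ s ∉ I, ∃ d, s * x = d * p) :
    ∃ V : ValuationSubring F, IsDiscreteValuationRing V ∧
      ∀ f, f ∈ V ↔ ∃ u s : A, s ∉ I ∧ f = algebraMap A F u * (algebraMap A F s)⁻¹ := by
  let S : Subalgebra A F :=
    Localization.subalgebra.ofField F I.primeCompl I.primeCompl_le_nonZeroDivisors
  have hloc : IsLocalization I.primeCompl S :=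
    Localization.subalgebra.isLocalization_ofField F I.primeCompl _
  have hno : IsNoetherianRing S := IsLocalization.isNoetherianRing I.primeCompl _ inferInstance
  have : IsLocalRing S := IsLocalization.AtPrime.isLocalRing S I
  have hnf : ¬ IsField S := IsLocalization.AtPrime.not_isField A hI0 S
  have key : (IsLocalRing.maximalIdeal S).IsPrincipal := by
    obtain ⟨p, hp, H⟩ := hgen
    refine ⟨algebraMap _ _ p, ?_⟩
    rw [← IsLocalization.AtPrime.map_eq_maximalIdeal I S]
    refine le_antisymm (Ideal.map_le_iff_le_comap.2 fun x hx => ?_) ?_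
    · obtain ⟨s, hs, d, e⟩ := H x hx
      have hu : IsUnit (algebraMap A S s) :=
        IsLocalization.map_units S (⟨s, hs⟩ : I.primeCompl)
      rw [Ideal.mem_comap, ← Ideal.unit_mul_mem_iff_mem _ hu, ← map_mul, e, map_mul]
      exact Ideal.mul_mem_left _ _ (Ideal.mem_span_singleton_self _)
    · exact (Ideal.span_singleton_le_iff_mem _).2 (Ideal.mem_map_of_mem _ hp)
  have hdvr : IsDiscreteValuationRing S := ((IsDiscreteValuationRing.TFAE S hnf).out 4 0).1 key
  refine ⟨.ofSubring S.toSubring fun x => ?_, hdvr, fun f => ?_⟩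
  · simpa [IsLocalization.IsInteger] using ValuationRing.isInteger_or_isInteger S x
  · constructor
    · rintro ⟨u, s, hs, e⟩
      exact ⟨u, s, hs, e⟩
    · rintro ⟨u, s, hs, e⟩
      exact ⟨u, s, hs, e⟩

/-- Nullstellensatz: A/I is a finite extension of `L`, hence embeds into `Ω`. -/
theorem exists_algHom_of_isMaximal {L A Ω : Type*} [Field L] [CommRing A] [Algebra L A]
    [Algebra.FiniteType L A] [Field Ω] [Algebra L Ω] [IsAlgClosed Ω] (I : Ideal A)
    [hI : I.IsMaximal] : ∃ φ : A →ₐ[L] Ω, ∀ x, φ x = 0 ↔ x ∈ I := by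
  let : Field (A ⧸ I) := Ideal.Quotient.field I
  have hft : Algebra.FiniteType L (A ⧸ I) :=
    Algebra.FiniteType.of_surjective (Ideal.Quotient.mkₐ L I) (Ideal.Quotient.mkₐ_surjective L I)
  have hfin : Module.Finite L (A ⧸ I) := finite_of_finite_type_of_isJacobsonRing L (A ⧸ I)
  have halg : Algebra.IsAlgebraic L (A ⧸ I) := inferInstance
  let φ : (A ⧸ I) →ₐ[L] Ω := IsAlgClosed.lift
  refine ⟨φ.comp (Ideal.Quotient.mkₐ L I), fun x => ?_⟩
  rw [← Ideal.Quotient.eq_zero_iff_mem]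
  exact map_eq_zero_iff φ φ.injective

/-! ### The affine curve: its places and its normality -/

namespace CabCurve

variable {L : Type*} [Field L] {a b : ℕ} (X : CabCurve L a b)

/-! Shortcuts for the instance search on the function field. -/

noncomputable scoped instance : Field X.FunField := inferInstance
noncomputable scoped instance : CommRing X.FunField := inferInstance
noncomputable scoped instance : Ring X.FunField := inferInstance
noncomputable scoped instance : CommSemiring X.FunField := inferInstance
noncomputable scoped instance : Semiring X.FunField := inferInstance
noncomputable scoped instance : AddCommGroup X.FunField := inferInstance
noncomputable scoped instance : AddCommMonoid X.FunField := inferInstance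
noncomputable scoped instance : Algebra L X.FunField := inferInstance
noncomputable scoped instance : Module L X.FunField := inferInstance
noncomputable scoped instance : SMul L X.FunField := inferInstance
noncomputable scoped instance : Mul X.FunField := inferInstance
noncomputable scoped instance : Add X.FunField := inferInstance
noncomputable scoped instance : Monoid X.FunField := inferInstance

instance isNoetherianRing_coordRing : IsNoetherianRing X.CoordRing :=
  inferInstanceAs (IsNoetherianRing (MvPolynomial (Fin 2) L ⧸ Ideal.span {X.poly}))

theorem exists_geometric_point (I : Ideal X.CoordRing) [hI : I.IsMaximal] :
    ∃ z : Fin 2 → AlgebraicClosure L, ∀ h : MvPolynomial (Fin 2) L,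
      (Ideal.Quotient.mk _ h : X.CoordRing) ∈ I ↔ MvPolynomial.aeval z h = 0 := by
  have : Algebra.FiniteType L X.CoordRing :=
    Algebra.FiniteType.of_surjective (Ideal.Quotient.mkₐ L (Ideal.span {X.poly}))
      (Ideal.Quotient.mkₐ_surjective L _)
  obtain ⟨φ, hφ⟩ := exists_algHom_of_isMaximal (L := L) (Ω := AlgebraicClosure L) I
  let ψ : MvPolynomial (Fin 2) L →ₐ[L] AlgebraicClosure L :=
    φ.comp (Ideal.Quotient.mkₐ L (Ideal.span {X.poly}))
  refine ⟨fun l => ψ (MvPolynomial.X l), fun h => ?_⟩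
  have : MvPolynomial.aeval (fun l => ψ (MvPolynomial.X l)) = ψ := by
    ext l; simp
  rw [this, ← hφ]
  rfl

theorem exists_local_generator (I : Ideal X.CoordRing) [hI : I.IsMaximal] :
    ∃ p ∈ I, ∀ x ∈ I, ∃ s ∉ I, ∃ d, s * x = d * p := by
  obtain ⟨z, hz⟩ := X.exists_geometric_point I
  have hf : MvPolynomial.aeval z X.poly = 0 := by
    rw [← hz, Ideal.Quotient.eq_zero_iff_mem.2 (Ideal.mem_span_singleton_self _)]
    exact I.zero_mem
  obtain ⟨j, hj⟩ := X.nonsingular z hf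
  obtain ⟨p, hp, H⟩ := exists_generator_of_pderiv_ne_zero z X.poly hf j hj
  refine ⟨Ideal.Quotient.mk _ p, (hz p).2 hp, fun x hx => ?_⟩
  obtain ⟨h, rfl⟩ := Ideal.Quotient.mk_surjective x
  obtain ⟨B, C, D, hB, e⟩ := H h ((hz h).1 hx)
  refine ⟨Ideal.Quotient.mk _ B, fun hB' => hB ((hz B).1 hB'), Ideal.Quotient.mk _ D, ?_⟩
  rw [← map_mul, e, map_add, map_mul, map_mul,
    Ideal.Quotient.eq_zero_iff_mem.2 (Ideal.mem_span_singleton_self X.poly)]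
  ring

theorem exists_place (I : Ideal X.CoordRing) [hI : I.IsMaximal] (hI0 : I ≠ ⊥) :
    ∃ P : Place L X.FunField, ∀ f, f ∈ P.ring ↔ ∃ u s : X.CoordRing, s ∉ I ∧
      f = algebraMap _ X.FunField u * (algebraMap _ X.FunField s)⁻¹ := by
  obtain ⟨V, hV, hmem⟩ := exists_valuationSubring_of_local_generator (F := X.FunField) I hI0
    (X.exists_local_generator I)
  refine ⟨⟨V, hV, fun c => (hmem _).2 ⟨algebraMap L X.CoordRing c, 1, ?_, ?_⟩⟩, hmem⟩
  · exact fun h => hI.ne_top ((Ideal.eq_top_iff_one _).2 h)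
  · rw [map_one, inv_one, mul_one, ← IsScalarTower.algebraMap_apply]

/-- The functions that are regular on the affine curve. -/
noncomputable def affine : Subalgebra L X.FunField :=
  (IsScalarTower.toAlgHom L X.CoordRing X.FunField).range

theorem algebraMap_mem_affine (u : X.CoordRing) : algebraMap _ X.FunField u ∈ X.affine :=
  ⟨u, rfl⟩

theorem x_mem_affine : X.x ∈ X.affine := X.algebraMap_mem_affine _

theorem y_mem_affine : X.y ∈ X.affine := X.algebraMap_mem_affine _

/-- The affine curve is normal. -/
theorem mem_affine_of_forall_place {f : X.FunField}
    (hf : ∀ P : Place L X.FunField, ¬ X.IsAtInfinity P → f ∈ P.ring) : f ∈ X.affine := by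
  have h1 : f ∈ (⨅ v : MaximalSpectrum X.CoordRing,
      Localization.subalgebra.ofField X.FunField v.asIdeal.primeCompl
        v.asIdeal.primeCompl_le_nonZeroDivisors) := by
    rw [Algebra.mem_iInf]
    intro v
    have := v.isMaximal
    have h2 : ∃ u s : X.CoordRing, s ∉ v.asIdeal ∧
        f = algebraMap _ X.FunField u * (algebraMap _ X.FunField s)⁻¹ := by
      -- Localizing at the zero ideal gives the whole function field, so this case asks for no
      -- place.
      by_cases hv : v.asIdeal = ⊥
      · obtain ⟨u, s, hs, e⟩ := IsFractionRing.div_surjective X.CoordRing f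
        refine ⟨u, s, ?_, by rw [← e, div_eq_mul_inv]⟩
        rw [hv]
        exact fun h => nonZeroDivisors.ne_zero hs h
      · obtain ⟨P, hP⟩ := X.exists_place v.asIdeal hv
        have hreg : ∀ u : X.CoordRing, algebraMap _ X.FunField u ∈ P.ring := fun u =>
          (hP _).2 ⟨u, 1, v.isMaximal.isPrime.one_notMem, by rw [map_one, inv_one, mul_one]⟩
        exact (hP f).1 (hf P fun h => h ⟨hreg _, hreg _⟩)
    obtain ⟨u, s, hs, e⟩ := h2
    exact ⟨u, s, hs, e⟩
  rw [MaximalSpectrum.iInf_localization_eq_bot] at h1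
  obtain ⟨u, hu⟩ := h1
  exact ⟨u, hu⟩

/-- A place is determined by its center on the affine curve. -/
theorem eq_of_center_eq {P Q : Place L X.FunField} (I : Ideal X.CoordRing)
    [hI : I.IsMaximal] (hI0 : I ≠ ⊥)
    (hP : ∀ u : X.CoordRing, P.val (algebraMap _ X.FunField u) < 1 → u ∈ I)
    (hPreg : ∀ u : X.CoordRing, P.val (algebraMap _ X.FunField u) ≤ 1)
    (hQ : ∀ u : X.CoordRing, Q.val (algebraMap _ X.FunField u) < 1 → u ∈ I)
    (hQreg : ∀ u : X.CoordRing, Q.val (algebraMap _ X.FunField u) ≤ 1) : P = Q := by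
  obtain ⟨R, hR⟩ := X.exists_place I hI0
  -- Elements outside I are units at P, so the local ring at I is contained in that of P; the former
  -- is already a place, which forces equality.
  have key : ∀ P : Place L X.FunField,
      (∀ u : X.CoordRing, P.val (algebraMap _ X.FunField u) < 1 → u ∈ I) →
      (∀ u : X.CoordRing, P.val (algebraMap _ X.FunField u) ≤ 1) → R = P := by
    intro P h hreg
    refine Place.eq_of_ring_le fun f hf => ?_
    obtain ⟨u, s, hs, rfl⟩ := (hR f).1 hf
    rw [Place.mem_ring_iff, map_mul, map_inv₀]
    have : P.val (algebraMap _ X.FunField s) = 1 :=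
      le_antisymm (hreg s) (not_lt.1 fun h' => hs (h s h'))
    rw [this, inv_one, mul_one]
    exact hreg u
  rw [← key P hP hPreg, ← key Q hQ hQreg]

end CabCurve

/-! ### Weighted degrees and the place at infinity -/

namespace CabCurve

variable {L : Type*} [Field L] {a b : ℕ} (X : CabCurve L a b)

/-- Modulo a the weight determines bj, hence j, since b is invertible modulo a and 0 ≤ j < a. -/
theorem weight_injective (X : CabCurve L a b) {i j i' j' : ℕ} (hj : j < a) (hj' : j' < a)
    (h : a * i + b * j = a * i' + b * j') : i = i' ∧ j = j' := by
  have ha := X.a_pos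
  have h1 : b * j ≡ b * j' [MOD a] := by
    have : a * i + b * j ≡ a * i' + b * j' [MOD a] := by rw [h]
    simpa [Nat.ModEq, Nat.mul_add_mod] using this
  have h2 : j ≡ j' [MOD a] := Nat.ModEq.cancel_left_of_coprime X.coprime h1
  have h3 : j = j' := Nat.ModEq.eq_of_lt_of_lt h2 hj hj'
  subst h3
  exact ⟨Nat.eq_of_mul_eq_mul_left ha (by omega), rfl⟩

/-- The span of the monomials `x^i y^j`, `j < a`, of weighted degree at most `n`. -/
noncomputable def lowDegree (n : ℤ) : Submodule L X.FunField :=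
  Submodule.span L {f | ∃ i j : ℕ, j < a ∧ ((a * i + b * j : ℕ) : ℤ) ≤ n ∧ f = X.x ^ i * X.y ^ j}

theorem monomial_mem_lowDegree {i j : ℕ} (hj : j < a) {n : ℤ}
    (h : ((a * i + b * j : ℕ) : ℤ) ≤ n) : X.x ^ i * X.y ^ j ∈ X.lowDegree n :=
  Submodule.subset_span ⟨i, j, hj, h, rfl⟩

theorem lowDegree_mono {n n' : ℤ} (h : n ≤ n') : X.lowDegree n ≤ X.lowDegree n' :=
  Submodule.span_mono fun _ ⟨i, j, hj, hn, e⟩ => ⟨i, j, hj, hn.trans h, e⟩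

theorem lowDegree_of_neg {n : ℤ} (hn : n < 0) : X.lowDegree n = ⊥ := by
  rw [lowDegree, Submodule.span_eq_bot]
  rintro _ ⟨i, j, -, h, -⟩
  omega

theorem lowDegree_le_affine (n : ℤ) : X.lowDegree n ≤ Subalgebra.toSubmodule X.affine := by
  refine Submodule.span_le.2 ?_
  rintro _ ⟨i, j, -, -, rfl⟩
  exact X.affine.mul_mem (pow_mem X.x_mem_affine i) (pow_mem X.y_mem_affine j)

theorem isLeadingMonomial_iff {f : X.FunField} {β α : ℕ} :
    X.IsLeadingMonomial f β α ↔ α < a ∧ ∃ c : L, c ≠ 0 ∧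
      f - c • (X.x ^ β * X.y ^ α) ∈ X.lowDegree ((a * β + b * α : ℕ) - 1) := by
  have : {f | ∃ i j : ℕ, j < a ∧ a * i + b * j < a * β + b * α ∧ f = X.x ^ i * X.y ^ j} =
      {f | ∃ i j : ℕ, j < a ∧ ((a * i + b * j : ℕ) : ℤ) ≤ ((a * β + b * α : ℕ) : ℤ) - 1 ∧
        f = X.x ^ i * X.y ^ j} := by
    ext f
    constructor
    · rintro ⟨i, j, hj, h, e⟩
      exact ⟨i, j, hj, by omega, e⟩
    · rintro ⟨i, j, hj, h, e⟩
      exact ⟨i, j, hj, by omega, e⟩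
  rw [IsLeadingMonomial, this]
  rfl

theorem exists_isLeadingMonomial_of_mem_lowDegree {n : ℤ} {f : X.FunField}
    (hf : f ∈ X.lowDegree n) (hf0 : f ≠ 0) :
    ∃ β α, X.IsLeadingMonomial f β α ∧ ((a * β + b * α : ℕ) : ℤ) ≤ n := by
  -- The shift by one lets the induction start at degree ≤ -1, where the space is zero.
  suffices H : ∀ N : ℕ, ∀ f ∈ X.lowDegree ((N : ℤ) - 1), f ≠ 0 →
      ∃ β α, X.IsLeadingMonomial f β α ∧ ((a * β + b * α : ℕ) : ℤ) ≤ (N : ℤ) - 1 by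
    rcases lt_or_ge n 0 with hn | hn
    · rw [X.lowDegree_of_neg hn] at hf
      exact absurd hf hf0
    · obtain ⟨N, rfl⟩ : ∃ N : ℕ, n = (N : ℤ) - 1 := ⟨(n + 1).toNat, by omega⟩
      exact H N f hf hf0
  intro N
  induction N with
  | zero =>
    intro f hf hf0
    rw [X.lowDegree_of_neg (by simp)] at hf
    exact absurd hf hf0
  | succ N ih =>
    intro f hf hf0
    by_cases hN : ∃ i j, j < a ∧ a * i + b * j = N
    · obtain ⟨i, j, hj, hij⟩ := hN
      have hset : X.lowDegree (((N + 1 : ℕ) : ℤ) - 1) ≤ Submodule.span L (insert (X.x ^ i * X.y ^ j)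
          {f | ∃ i j : ℕ, j < a ∧ ((a * i + b * j : ℕ) : ℤ) ≤ (N : ℤ) - 1 ∧
            f = X.x ^ i * X.y ^ j}) := by
        refine Submodule.span_mono ?_
        rintro _ ⟨i', j', hj', h, rfl⟩
        rcases lt_or_eq_of_le (show a * i' + b * j' ≤ N by omega) with h' | h'
        · exact Or.inr ⟨i', j', hj', by omega, rfl⟩
        · obtain ⟨rfl, rfl⟩ := X.weight_injective hj' hj (h'.trans hij.symm)
          exact Or.inl rfl
      obtain ⟨c, f', hf', rfl⟩ := Submodule.mem_span_insert.1 (hset hf)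
      change f' ∈ X.lowDegree ((N : ℤ) - 1) at hf'
      by_cases hc : c = 0
      · rw [hc, zero_smul, zero_add] at hf0 ⊢
        obtain ⟨β, α, h, hle⟩ := ih f' hf' hf0
        exact ⟨β, α, h, by omega⟩
      · refine ⟨i, j, X.isLeadingMonomial_iff.2 ⟨hj, c, hc, ?_⟩, by omega⟩
        rwa [add_sub_cancel_left, hij]
    · have hle : X.lowDegree (((N + 1 : ℕ) : ℤ) - 1) ≤ X.lowDegree ((N : ℤ) - 1) := by
        refine Submodule.span_mono ?_
        rintro _ ⟨i', j', hj', h, rfl⟩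
        refine ⟨i', j', hj', ?_, rfl⟩
        have : a * i' + b * j' ≠ N := fun h' => hN ⟨i', j', hj', h'⟩
        omega
      obtain ⟨β, α, h, hle'⟩ := ih f (hle hf) hf0
      exact ⟨β, α, h, by omega⟩

/-- The homomorphism from polynomials to functions. -/
noncomputable def polyMap : MvPolynomial (Fin 2) L →ₐ[L] X.FunField :=
  (IsScalarTower.toAlgHom L X.CoordRing X.FunField).comp
    (Ideal.Quotient.mkₐ L (Ideal.span {X.poly}))

theorem polyMap_X_zero : X.polyMap (MvPolynomial.X 0) = X.x := rfl

theorem polyMap_X_one : X.polyMap (MvPolynomial.X 1) = X.y := rfl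

theorem polyMap_poly : X.polyMap X.poly = 0 := by
  change algebraMap X.CoordRing X.FunField (Ideal.Quotient.mk _ X.poly) = 0
  rw [Ideal.Quotient.eq_zero_iff_mem.2 (Ideal.mem_span_singleton_self _), map_zero]

theorem polyMap_monomial (d : Fin 2 →₀ ℕ) (c : L) :
    X.polyMap (MvPolynomial.monomial d c) = c • (X.x ^ d 0 * X.y ^ d 1) := by
  rw [MvPolynomial.monomial_eq, map_mul, MvPolynomial.algHom_C, Finsupp.prod_fintype _ _ (by simp),
    Fin.prod_univ_two, map_mul, map_pow, map_pow, polyMap_X_zero, polyMap_X_one, Algebra.smul_def]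

/-- The equation of the curve, with the two leading terms separated. -/
theorem exists_relation : ∃ c d : L, c ≠ 0 ∧ d ≠ 0 ∧ ∃ r ∈ Submodule.span L
    {f | ∃ i j : ℕ, a * i + b * j < a * b ∧ f = X.x ^ i * X.y ^ j},
    c • X.y ^ a + d • X.x ^ b + r = 0 := by
  have h := X.polyMap_poly
  replace h := (congrArg X.polyMap X.poly.as_sum).symm.trans h
  rw [map_sum] at h
  have hne : (Finsupp.single 0 b : Fin 2 →₀ ℕ) ≠ Finsupp.single 1 a := by
    intro h'
    have := DFunLike.congr_fun h' 1
    simp at this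
    exact X.a_pos.ne this
  have hy : (Finsupp.single 1 a : Fin 2 →₀ ℕ) ∈ X.poly.support :=
    MvPolynomial.mem_support_iff.2 X.coeff_y
  have hx : (Finsupp.single 0 b : Fin 2 →₀ ℕ) ∈ X.poly.support.erase (Finsupp.single 1 a) :=
    Finset.mem_erase.2 ⟨hne, MvPolynomial.mem_support_iff.2 X.coeff_x⟩
  rw [← Finset.add_sum_erase _ _ hy, ← Finset.add_sum_erase _ _ hx, ← add_assoc,
    polyMap_monomial, polyMap_monomial] at h
  simp only [Finsupp.single_apply] at h
  refine ⟨_, _, X.coeff_y, X.coeff_x, _, ?_, by simpa using h⟩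
  refine Submodule.sum_mem _ fun e he => ?_
  rw [polyMap_monomial]
  refine Submodule.smul_mem _ _ (Submodule.subset_span ⟨e 0, e 1, ?_, rfl⟩)
  simp only [Finset.mem_erase] at he
  rcases X.weight_lt e he.2.2 with h' | h' | h'
  · exact absurd h' he.2.1
  · exact absurd h' he.1
  · exact h'

theorem affine_le_span : ∀ f ∈ X.affine,
    f ∈ Submodule.span L {f | ∃ i j : ℕ, j < a ∧ f = X.x ^ i * X.y ^ j} := by
  set S := Submodule.span L {f | ∃ i j : ℕ, j < a ∧ f = X.x ^ i * X.y ^ j} with hS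
  have hx : ∀ f ∈ S, X.x * f ∈ S := by
    intro f hf
    induction hf using Submodule.span_induction with
    | mem f hf =>
      obtain ⟨i, j, hj, rfl⟩ := hf
      exact Submodule.subset_span ⟨i + 1, j, hj, by ring⟩
    | zero => rw [mul_zero]; exact S.zero_mem
    | add f g _ _ hf hg => rw [mul_add]; exact S.add_mem hf hg
    | smul c f _ hf => rw [mul_smul_comm]; exact S.smul_mem c hf
  have hxn : ∀ n, ∀ f ∈ S, X.x ^ n * f ∈ S := by
    intro n
    induction n with
    | zero => intro f hf; simpa using hf
    | succ n ih => intro f hf; rw [pow_succ', mul_assoc]; exact hx _ (ih f hf)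
  -- The equation of the curve expresses y^a through x^b and monomials with ai + bj < ab, and the
  -- latter inequality forces j < a.
  have hya : X.y ^ a ∈ S := by
    obtain ⟨c, d, hc, -, r, hr, e⟩ := X.exists_relation
    have h1 : c • X.y ^ a = -(d • X.x ^ b + r) := by
      rw [eq_neg_iff_add_eq_zero, ← add_assoc]; exact e
    have h2 : r ∈ S := by
      refine Submodule.span_mono ?_ hr
      rintro _ ⟨i, j, h, rfl⟩
      refine ⟨i, j, ?_, rfl⟩
      have : b * j < b * a := by rw [mul_comm b a]; omega
      exact lt_of_mul_lt_mul_left this (Nat.zero_le _)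
    have h3 : X.x ^ b ∈ S := Submodule.subset_span ⟨b, 0, X.a_pos, by ring⟩
    have h4 : c • X.y ^ a ∈ S := h1 ▸ S.neg_mem (S.add_mem (S.smul_mem d h3) h2)
    exact (Submodule.smul_mem_iff S hc).1 h4
  have hy : ∀ f ∈ S, X.y * f ∈ S := by
    intro f hf
    induction hf using Submodule.span_induction with
    | mem f hf =>
      obtain ⟨i, j, hj, rfl⟩ := hf
      rcases lt_or_eq_of_le (show j + 1 ≤ a from hj) with h | h
      · exact Submodule.subset_span ⟨i, j + 1, h, by ring⟩
      · have : X.y * (X.x ^ i * X.y ^ j) = X.x ^ i * X.y ^ a := by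
          rw [show X.y ^ a = X.y ^ (j + 1) from congrArg (X.y ^ ·) h.symm]; ring
        rw [this]
        exact hxn i _ hya
    | zero => rw [mul_zero]; exact S.zero_mem
    | add f g _ _ hf hg => rw [mul_add]; exact S.add_mem hf hg
    | smul c f _ hf => rw [mul_smul_comm]; exact S.smul_mem c hf
  rintro _ ⟨u, rfl⟩
  obtain ⟨p, rfl⟩ := Ideal.Quotient.mk_surjective u
  change X.polyMap p ∈ S
  induction p using MvPolynomial.induction_on with
  | C c =>
    rw [MvPolynomial.algHom_C, Algebra.algebraMap_eq_smul_one]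
    exact S.smul_mem c (Submodule.subset_span ⟨0, 0, X.a_pos, by ring⟩)
  | add p q hp hq => rw [map_add]; exact S.add_mem hp hq
  | mul_X p l hp =>
    rw [map_mul, mul_comm]
    fin_cases l
    · exact hx _ hp
    · exact hy _ hp

theorem exists_mem_lowDegree {f : X.FunField} (hf : f ∈ X.affine) : ∃ n, f ∈ X.lowDegree n := by
  have h := X.affine_le_span f hf
  clear hf
  induction h using Submodule.span_induction with
  | mem f hf =>
    obtain ⟨i, j, hj, rfl⟩ := hf
    exact ⟨_, X.monomial_mem_lowDegree hj le_rfl⟩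
  | zero => exact ⟨0, Submodule.zero_mem _⟩
  | add f g _ _ hf hg =>
    obtain ⟨n, hn⟩ := hf
    obtain ⟨n', hn'⟩ := hg
    exact ⟨max n n', Submodule.add_mem _ (X.lowDegree_mono (le_max_left _ _) hn)
      (X.lowDegree_mono (le_max_right _ _) hn')⟩
  | smul c f _ hf =>
    obtain ⟨n, hn⟩ := hf
    exact ⟨n, Submodule.smul_mem _ c hn⟩

section Infinity

variable {X} {P : Place L X.FunField} (hP : X.IsAtInfinity P)

include hP in
-- Let M be the larger of the valuations of x^b and y^a; it exceeds 1 because x or y has a pole. By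
-- ai + bj < ab every other term of the equation has valuation below M, so the two leading terms
-- must have equal valuation. Coprimality of a and b then makes the pole orders a common multiple t
-- of (a, b).
theorem exists_val_x_y_eq : ∃ t : ℤ, 0 < t ∧ P.val X.x = WithZero.exp (a * t) ∧
    P.val X.y = WithZero.exp (b * t) := by
  have ha := X.a_pos
  have hb := X.b_pos
  obtain ⟨c, d, hc, hd, r, hr, e⟩ := X.exists_relation
  set M := max (P.val X.x ^ b) (P.val X.y ^ a) with hM
  have hM1 : 1 < M := by
    rw [IsAtInfinity, P.mem_ring_iff, P.mem_ring_iff, not_and_or, not_le, not_le] at hP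
    rcases hP with h | h
    · exact lt_max_of_lt_left (one_lt_pow₀ h hb.ne')
    · exact lt_max_of_lt_right (one_lt_pow₀ h ha.ne')
  have hrM : P.val r < M := by
    clear e
    induction hr using Submodule.span_induction with
    | mem f hf =>
      obtain ⟨i, j, hij, rfl⟩ := hf
      refine lt_of_pow_lt_pow_left₀ (a * b) zero_le ?_
      calc P.val (X.x ^ i * X.y ^ j) ^ (a * b)
          = (P.val X.x ^ b) ^ (a * i) * (P.val X.y ^ a) ^ (b * j) := by
            rw [map_mul, map_pow, map_pow, mul_pow, ← pow_mul, ← pow_mul, ← pow_mul, ← pow_mul]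
            congr 2 <;> ring
        _ ≤ M ^ (a * i) * M ^ (b * j) := by
            gcongr
            · exact le_max_left _ _
            · exact le_max_right _ _
        _ = M ^ (a * i + b * j) := by rw [pow_add]
        _ < M ^ (a * b) := pow_lt_pow_right₀ hM1 hij
    | zero => rw [map_zero]; exact zero_lt_one.trans hM1
    | add f g _ _ hf hg => exact P.val.map_add_lt hf hg
    | smul c f _ hf => exact (P.val_smul_le c f).trans_lt hf
  have heq : P.val X.x ^ b = P.val X.y ^ a := by
    by_contra hne
    have h1 : P.val (c • X.y ^ a + d • X.x ^ b) = M := by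
      rw [P.val.map_add_of_distinct_val (by
        rw [P.val_smul hc, P.val_smul hd, map_pow, map_pow]; exact fun h => hne h.symm),
        P.val_smul hc, P.val_smul hd, map_pow, map_pow, max_comm]
    rw [eq_neg_of_add_eq_zero_left e, Valuation.map_neg] at h1
    exact hrM.ne h1
  rw [heq, max_self] at hM
  have hy0 : P.val X.y ≠ 0 := by
    intro h
    rw [hM, h, zero_pow ha.ne'] at hM1
    exact absurd hM1 (by simp)
  have hx0 : P.val X.x ≠ 0 := by
    intro h
    rw [h, zero_pow hb.ne'] at heq
    exact hy0 (pow_eq_zero_iff ha.ne' |>.1 heq.symm)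
  have hlog : (b : ℤ) * WithZero.log (P.val X.x) = a * WithZero.log (P.val X.y) := by
    have := congrArg WithZero.log heq
    simpa [WithZero.log_pow] using this
  have hpos : 0 < (a : ℤ) * WithZero.log (P.val X.y) := by
    have h1 : (1 : ℤᵐ⁰) < P.val X.y ^ a := hM ▸ hM1
    rw [← WithZero.exp_zero, ← WithZero.lt_log_iff_exp_lt (pow_ne_zero _ hy0)] at h1
    simpa [WithZero.log_pow] using h1
  have hdvd : (a : ℤ) ∣ WithZero.log (P.val X.x) := by
    have h1 : (a : ℤ) ∣ b * WithZero.log (P.val X.x) := ⟨_, hlog⟩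
    exact (Nat.isCoprime_iff_coprime.2 X.coprime).dvd_of_dvd_mul_left h1
  obtain ⟨t, ht⟩ := hdvd
  have hyt : WithZero.log (P.val X.y) = b * t := by
    have ha' : (a : ℤ) ≠ 0 := by exact_mod_cast ha.ne'
    apply mul_left_cancel₀ ha'
    rw [← hlog, ht]; ring
  refine ⟨t, ?_, by rw [← ht, WithZero.exp_log hx0], by rw [← hyt, WithZero.exp_log hy0]⟩
  rw [hyt] at hpos
  by_contra hneg
  have : (a : ℤ) * (b * t) ≤ 0 := by
    have : (b : ℤ) * t ≤ 0 := mul_nonpos_of_nonneg_of_nonpos (by positivity) (not_lt.1 hneg)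
    exact mul_nonpos_of_nonneg_of_nonpos (by positivity) this
  omega

theorem val_monomial_aux {t : ℤ} (hx : P.val X.x = WithZero.exp (a * t))
    (hy : P.val X.y = WithZero.exp (b * t)) (i j : ℕ) :
    P.val (X.x ^ i * X.y ^ j) = WithZero.exp ((a * i + b * j : ℕ) * t) := by
  rw [map_mul, map_pow, map_pow, hx, hy, ← WithZero.exp_nsmul, ← WithZero.exp_nsmul,
    ← WithZero.exp_add]
  congr 1
  push_cast
  simp only [nsmul_eq_mul]
  ring

theorem val_le_of_mem_lowDegree_aux {t : ℤ} (ht : 0 < t) (hx : P.val X.x = WithZero.exp (a * t))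
    (hy : P.val X.y = WithZero.exp (b * t)) {n : ℤ} {f : X.FunField} (hf : f ∈ X.lowDegree n) :
    P.val f ≤ WithZero.exp (n * t) := by
  have h : X.lowDegree n ≤ P.valLE (WithZero.exp (n * t)) := by
    refine Submodule.span_le.2 ?_
    rintro _ ⟨i, j, -, hn, rfl⟩
    change P.val _ ≤ _
    rw [val_monomial_aux hx hy, WithZero.exp_le_exp]
    exact mul_le_mul_of_nonneg_right hn ht.le
  exact h hf

theorem val_of_isLeadingMonomial_aux {t : ℤ} (ht : 0 < t)
    (hx : P.val X.x = WithZero.exp (a * t)) (hy : P.val X.y = WithZero.exp (b * t))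
    {f : X.FunField} {β α : ℕ} (hf : X.IsLeadingMonomial f β α) :
    P.val f = WithZero.exp ((a * β + b * α : ℕ) * t) := by
  obtain ⟨-, c, hc, h⟩ := X.isLeadingMonomial_iff.1 hf
  have h1 := val_le_of_mem_lowDegree_aux ht hx hy h
  have h2 : P.val (c • (X.x ^ β * X.y ^ α)) = WithZero.exp ((a * β + b * α : ℕ) * t) := by
    rw [P.val_smul hc, val_monomial_aux hx hy]
  have h3 : P.val (f - c • (X.x ^ β * X.y ^ α)) < P.val (c • (X.x ^ β * X.y ^ α)) := by
    rw [h2]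
    refine h1.trans_lt (WithZero.exp_lt_exp.2 ?_)
    exact mul_lt_mul_of_pos_right (by omega) ht
  have : f = (f - c • (X.x ^ β * X.y ^ α)) + c • (X.x ^ β * X.y ^ α) := by ring
  rw [this, P.val.map_add_eq_of_lt_right h3, h2]

include hP in
/-- The pole orders of `x` and `y` at infinity are `a` and `b`. -/
theorem val_x_y_eq : P.val X.x = WithZero.exp (a : ℤ) ∧ P.val X.y = WithZero.exp (b : ℤ) := by
  obtain ⟨t, ht, hx, hy⟩ := exists_val_x_y_eq hP
  obtain ⟨π, hπ⟩ := P.exists_val_eq_exp_neg_one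
  obtain ⟨u, s, hs, rfl⟩ := IsFractionRing.div_surjective X.CoordRing π
  -- All nonzero regular functions have valuation in tℤ by their leading monomials, hence so do
  -- their quotients; a uniformizer then forces t = 1.
  have key : ∀ u : X.CoordRing, P.val (algebraMap _ X.FunField u) ≠ 0 →
      ∃ n : ℤ, P.val (algebraMap _ X.FunField u) = WithZero.exp (n * t) := by
    intro u hu
    obtain ⟨n, hn⟩ := X.exists_mem_lowDegree (X.algebraMap_mem_affine u)
    obtain ⟨β, α, h, -⟩ := X.exists_isLeadingMonomial_of_mem_lowDegree hn
      (by rintro h; rw [h, map_zero] at hu; exact hu rfl)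
    exact ⟨_, val_of_isLeadingMonomial_aux ht hx hy h⟩
  have hne : P.val (algebraMap _ X.FunField u / algebraMap _ X.FunField s) ≠ 0 := by
    rw [hπ]; exact WithZero.exp_ne_zero
  rw [map_div₀] at hne hπ
  obtain ⟨n, hn⟩ := key u (by rintro h; rw [h, zero_div] at hne; exact hne rfl)
  obtain ⟨n', hn'⟩ := key s (by rintro h; rw [h, div_zero] at hne; exact hne rfl)
  rw [hn, hn', ← WithZero.exp_sub, WithZero.exp_inj] at hπ
  have : t ∣ 1 := ⟨n' - n, by linarith⟩
  have h1 : t = 1 := Int.eq_one_of_dvd_one ht.le this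
  rw [h1, mul_one] at hx hy
  exact ⟨hx, hy⟩

include hP in
theorem val_le_of_mem_lowDegree {n : ℤ} {f : X.FunField} (hf : f ∈ X.lowDegree n) :
    P.val f ≤ WithZero.exp n := by
  obtain ⟨hx, hy⟩ := val_x_y_eq hP
  simpa using val_le_of_mem_lowDegree_aux (t := 1) one_pos (by simpa using hx) (by simpa using hy) hf

include hP in
theorem val_of_isLeadingMonomial {f : X.FunField} {β α : ℕ} (hf : X.IsLeadingMonomial f β α) :
    P.val f = WithZero.exp ((a * β + b * α : ℕ) : ℤ) := by
  obtain ⟨hx, hy⟩ := val_x_y_eq hP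
  simpa using val_of_isLeadingMonomial_aux (t := 1) one_pos (by simpa using hx)
    (by simpa using hy) hf

theorem mem_affine_of_isLeadingMonomial {f : X.FunField} {β α : ℕ}
    (hf : X.IsLeadingMonomial f β α) : f ∈ X.affine := by
  obtain ⟨-, c, -, h⟩ := X.isLeadingMonomial_iff.1 hf
  have h1 := X.lowDegree_le_affine _ h
  have h2 : X.x ^ β * X.y ^ α ∈ X.affine :=
    mul_mem (pow_mem X.x_mem_affine _) (pow_mem X.y_mem_affine _)
  have : f = (f - c • (X.x ^ β * X.y ^ α)) + c • (X.x ^ β * X.y ^ α) := by ring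
  rw [this]
  exact add_mem h1 (X.affine.smul_mem h2 c)

theorem exists_isLeadingMonomial {f : X.FunField} (hf : f ∈ X.affine) (hf0 : f ≠ 0) :
    ∃ β α, X.IsLeadingMonomial f β α := by
  obtain ⟨n, hn⟩ := X.exists_mem_lowDegree hf
  obtain ⟨β, α, h, -⟩ := X.exists_isLeadingMonomial_of_mem_lowDegree hn hf0
  exact ⟨β, α, h⟩

include hP in
theorem isLeadingMonomial_unique {f : X.FunField} {β α β' α' : ℕ}
    (h : X.IsLeadingMonomial f β α) (h' : X.IsLeadingMonomial f β' α') : β = β' ∧ α = α' := by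
  have e := (val_of_isLeadingMonomial hP h).symm.trans (val_of_isLeadingMonomial hP h')
  rw [WithZero.exp_inj] at e
  exact X.weight_injective h.1 h'.1 (by exact_mod_cast e)

include hP in
theorem mem_lowDegree_iff {n : ℤ} {f : X.FunField} :
    f ∈ X.lowDegree n ↔ f ∈ X.affine ∧ P.val f ≤ WithZero.exp n := by
  refine ⟨fun h => ⟨X.lowDegree_le_affine n h, val_le_of_mem_lowDegree hP h⟩, ?_⟩
  rintro ⟨hf, hn⟩
  by_cases hf0 : f = 0
  · rw [hf0]; exact Submodule.zero_mem _
  obtain ⟨β, α, h⟩ := exists_isLeadingMonomial hf hf0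
  rw [val_of_isLeadingMonomial hP h, WithZero.exp_le_exp] at hn
  obtain ⟨hα, c, -, h1⟩ := X.isLeadingMonomial_iff.1 h
  have : f = (f - c • (X.x ^ β * X.y ^ α)) + c • (X.x ^ β * X.y ^ α) := by ring
  rw [this]
  exact Submodule.add_mem _ (X.lowDegree_mono (by omega) h1)
    (Submodule.smul_mem _ _ (X.monomial_mem_lowDegree hα hn))

include hP in
/-- There is only one place at infinity. -/
theorem eq_of_isAtInfinity {Q : Place L X.FunField} (hQ : X.IsAtInfinity Q) : Q = P := by
  -- Both valuations are read off the same leading monomial.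
  have key : ∀ u : X.CoordRing, Q.val (algebraMap _ X.FunField u) =
      P.val (algebraMap _ X.FunField u) := by
    intro u
    by_cases hu : algebraMap _ X.FunField u = 0
    · rw [hu, map_zero, map_zero]
    obtain ⟨β, α, h⟩ := exists_isLeadingMonomial (X.algebraMap_mem_affine u) hu
    rw [val_of_isLeadingMonomial hP h, val_of_isLeadingMonomial hQ h]
  refine Place.eq_of_ring_le fun f hf => ?_
  rw [Place.mem_ring_iff] at hf ⊢
  obtain ⟨u, s, -, rfl⟩ := IsFractionRing.div_surjective X.CoordRing f
  rwa [map_div₀, ← key, ← key, ← map_div₀]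

theorem val_le_one_of_mem_affine {Q : Place L X.FunField} (hQ : ¬ X.IsAtInfinity Q)
    {f : X.FunField} (hf : f ∈ X.affine) : Q.val f ≤ 1 := by
  rw [IsAtInfinity, not_not, Q.mem_ring_iff, Q.mem_ring_iff] at hQ
  have h : Submodule.span L {f | ∃ i j : ℕ, j < a ∧ f = X.x ^ i * X.y ^ j} ≤ Q.valLE 1 := by
    refine Submodule.span_le.2 ?_
    rintro _ ⟨i, j, -, rfl⟩
    change Q.val _ ≤ 1
    rw [map_mul, map_pow, map_pow]
    exact mul_le_one' (pow_le_one' hQ.1 i) (pow_le_one' hQ.2 j)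
  exact h (X.affine_le_span f hf)

include hP in
-- Normality turns the absence of affine poles into membership in the coordinate ring, and the pole
-- order at infinity is the weight of the leading monomial. All later work with 𝓛(nP∞) takes place
-- in spans of monomials.
theorem riemannRoch_divisor_eq (n : ℤ) : riemannRoch (P.divisor n) = X.lowDegree n := by
  ext f
  rw [mem_lowDegree_iff hP]
  constructor
  · intro h
    refine ⟨X.mem_affine_of_forall_place fun Q hQ => ?_, ?_⟩
    · have h1 := h Q
      have hne : Q ≠ P := by rintro rfl; exact hQ hP
      rw [Place.divisor, if_neg hne, WithZero.exp_zero] at h1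
      exact Q.mem_ring_iff.2 h1
    · have h1 := h P
      rwa [Place.divisor, if_pos rfl] at h1
  · rintro ⟨hf, hn⟩ Q
    by_cases hQ : Q = P
    · rw [Place.divisor, if_pos hQ, hQ]; exact hn
    · rw [Place.divisor, if_neg hQ, WithZero.exp_zero]
      exact val_le_one_of_mem_affine (fun h => hQ (eq_of_isAtInfinity hP h)) hf

end Infinity

end CabCurve

/-! ### Division with remainder and the spaces of remainders -/

namespace CabCurve

variable {L : Type*} [Field L] {a b : ℕ} {X : CabCurve L a b}

theorem two_mul_genus (X : CabCurve L a b) : 2 * X.genus = (a - 1) * (b - 1) := by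
  refine Nat.mul_div_cancel' ?_
  have ha := X.a_pos
  have hb := X.b_pos
  rcases Nat.even_or_odd a with h | h
  · have : Odd b := by
      rw [← Nat.not_even_iff_odd]
      intro h'
      have := Nat.dvd_gcd h.two_dvd h'.two_dvd
      rw [X.coprime] at this
      omega
    obtain ⟨t, rfl⟩ := this
    exact Dvd.dvd.mul_left ⟨t, by omega⟩ _
  · obtain ⟨t, rfl⟩ := h
    exact Dvd.dvd.mul_right ⟨t, by omega⟩ _

theorem two_mul_genus_int (X : CabCurve L a b) :
    2 * (X.genus : ℤ) = ((a : ℤ) - 1) * ((b : ℤ) - 1) := by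
  have ha := X.a_pos
  have hb := X.b_pos
  have h := X.two_mul_genus
  zify [ha, hb] at h
  exact h

section Division

variable {P : Place L X.FunField} (hP : X.IsAtInfinity P)

set_option maxHeartbeats 1600000 in
include hP in
/-- Division with remainder by a function with a given leading monomial. -/
theorem exists_division {h : X.FunField} {β α : ℕ} (hh : X.IsLeadingMonomial h β α) {n : ℤ}
    {f : X.FunField} (hf : f ∈ X.lowDegree n) :
    ∃ r ∈ X.remainders h ⊓ X.lowDegree n, ∃ w ∈ X.affine, h * w ∈ X.lowDegree n ∧
      f = r + h * w := by
  suffices H : ∀ N : ℕ, ∀ f ∈ X.lowDegree ((N : ℤ) - 1),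
      ∃ r ∈ X.remainders h ⊓ X.lowDegree ((N : ℤ) - 1), ∃ w ∈ X.affine,
        h * w ∈ X.lowDegree ((N : ℤ) - 1) ∧ f = r + h * w by
    rcases lt_or_ge n 0 with hn | hn
    · rw [X.lowDegree_of_neg hn] at hf
      refine ⟨0, Submodule.zero_mem _, 0, X.affine.zero_mem, ?_, ?_⟩
      · rw [mul_zero]; exact Submodule.zero_mem _
      · rw [mul_zero, add_zero]; exact hf
    · obtain ⟨N, rfl⟩ : ∃ N : ℕ, n = (N : ℤ) - 1 := ⟨(n + 1).toNat, by omega⟩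
      exact H N f hf
  intro N
  induction N using Nat.strong_induction_on with
  | _ N ih =>
  intro f hf
  by_cases hf0 : f = 0
  · refine ⟨0, Submodule.zero_mem _, 0, X.affine.zero_mem, ?_, ?_⟩
    · rw [mul_zero]; exact Submodule.zero_mem _
    · rw [mul_zero, add_zero]; exact hf0
  obtain ⟨u, v, huv, hle⟩ := X.exists_isLeadingMonomial_of_mem_lowDegree hf hf0
  obtain ⟨hv, c, hc, hlow⟩ := X.isLeadingMonomial_iff.1 huv
  have hmono : X.lowDegree (((a * u + b * v : ℕ) : ℤ) - 1) ≤ X.lowDegree ((N : ℤ) - 1) :=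
    X.lowDegree_mono (by omega)
  -- Divisibility of leading terms is tested on weights, not on exponents: modulo the equation, the
  -- leading monomial of h x^i y^j need not be the product of the monomials, but its weight is the
  -- sum of the weights.
  by_cases hcase : ∃ i j, j < a ∧ a * i + b * j + (a * β + b * α) = a * u + b * v
  · obtain ⟨i, j, hj, hij⟩ := hcase
    set m := X.x ^ i * X.y ^ j with hm
    have hmA : m ∈ X.affine := X.affine.mul_mem (pow_mem X.x_mem_affine _) (pow_mem X.y_mem_affine _)
    have hgA : h * m ∈ X.affine := X.affine.mul_mem (mem_affine_of_isLeadingMonomial hh) hmA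
    have hval : P.val (h * m) = WithZero.exp ((a * u + b * v : ℕ) : ℤ) := by
      obtain ⟨hx, hy⟩ := val_x_y_eq hP
      have hmv := val_monomial_aux (P := P) (t := 1) (by simpa using hx) (by simpa using hy) i j
      rw [map_mul, val_of_isLeadingMonomial hP hh, hm, hmv, ← WithZero.exp_add, ← hij]
      congr 1
      push_cast
      ring
    have hg0 : h * m ≠ 0 := by
      intro h0
      rw [h0, map_zero] at hval
      exact WithZero.exp_ne_zero hval.symm
    obtain ⟨u', v', huv'⟩ := exists_isLeadingMonomial hgA hg0
    have hw := (val_of_isLeadingMonomial hP huv').symm.trans hval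
    rw [WithZero.exp_inj] at hw
    obtain ⟨rfl, rfl⟩ := X.weight_injective huv'.1 hv (by exact_mod_cast hw)
    obtain ⟨-, c', hc', hlow'⟩ := X.isLeadingMonomial_iff.1 huv'
    have hsub : f - (c / c') • (h * m) ∈ X.lowDegree (((a * u' + b * v' : ℕ) : ℤ) - 1) := by
      have e : f - (c / c') • (h * m) = (f - c • (X.x ^ u' * X.y ^ v')) -
          (c / c') • (h * m - c' • (X.x ^ u' * X.y ^ v')) := by
        rw [smul_sub, smul_smul, div_mul_cancel₀ c hc']
        abel
      rw [e]
      exact Submodule.sub_mem _ hlow (Submodule.smul_mem _ _ hlow')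
    obtain ⟨r, hr, w, hw, hhw, e⟩ := ih (a * u' + b * v') (by omega) _ hsub
    refine ⟨r, ⟨hr.1, hmono hr.2⟩, w + (c / c') • m,
      X.affine.add_mem hw (X.affine.smul_mem hmA _), ?_, ?_⟩
    · rw [mul_add, mul_smul_comm]
      refine Submodule.add_mem _ (hmono hhw) (Submodule.smul_mem _ _ ?_)
      refine (mem_lowDegree_iff hP).2 ⟨hgA, ?_⟩
      rw [hval, WithZero.exp_le_exp]
      exact hle
    · rw [mul_add, mul_smul_comm, ← add_assoc, ← e]
      abel
  · have hmem : X.x ^ u * X.y ^ v ∈ X.remainders h := by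
      have h1 : ¬ (β ≤ u ∧ α ≤ v) := by
        rintro ⟨h1, h2⟩
        obtain ⟨i, rfl⟩ := Nat.exists_eq_add_of_le h1
        obtain ⟨j, rfl⟩ := Nat.exists_eq_add_of_le h2
        exact hcase ⟨i, j, by omega, by ring⟩
      have hα := hh.1
      refine Submodule.subset_span ⟨β, α, u, v, hh, ?_, hv, h1, rfl⟩
      by_contra h2
      obtain ⟨i, rfl⟩ := Nat.exists_eq_add_of_le (not_lt.1 h2)
      have h3 : v < α := by
        by_contra h3
        exact h1 ⟨by omega, by omega⟩
      -- Here u ≥ β + b and v < α. Trading x^b for y^a, of equal weight, leaves the exponents u - b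
      -- ≥ β and v + a ≥ α, so the weight is reached after all. This explains the bound u < β + b in
      -- 𝓡(h).
      obtain ⟨j, hj⟩ := Nat.exists_eq_add_of_le (show α ≤ v + a by omega)
      refine hcase ⟨i, j, by omega, ?_⟩
      have : b * (v + a) = b * (α + j) := by rw [hj]
      linarith
    obtain ⟨r, hr, w, hw, hhw, e⟩ := ih (a * u + b * v) (by omega) _ hlow
    refine ⟨r + c • (X.x ^ u * X.y ^ v), ?_, w, hw, hmono hhw, ?_⟩
    · refine Submodule.add_mem _ ⟨hr.1, hmono hr.2⟩ (Submodule.smul_mem _ _ ⟨hmem, ?_⟩)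
      exact X.monomial_mem_lowDegree hv hle
    · rw [add_right_comm, ← e, sub_add_cancel]

include hP in
theorem remainders_eq {h : X.FunField} {β α : ℕ} (hh : X.IsLeadingMonomial h β α) :
    X.remainders h = Submodule.span L {f | ∃ u v : ℕ, u < β + b ∧ v < a ∧ ¬ (β ≤ u ∧ α ≤ v) ∧
      f = X.x ^ u * X.y ^ v} := by
  rw [remainders]
  congr 1
  ext f
  constructor
  · rintro ⟨β', α', u, v, h', h1, h2, h3, rfl⟩
    obtain ⟨rfl, rfl⟩ := isLeadingMonomial_unique hP hh h'
    exact ⟨u, v, h1, h2, h3, rfl⟩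
  · rintro ⟨u, v, h1, h2, h3, rfl⟩
    exact ⟨β, α, u, v, hh, h1, h2, h3, rfl⟩

include hP in
-- The extreme exponents are (β - 1, a - 1) and (β + b - 1, α - 1), and ab - a - b = 2γ - 1.
theorem remainders_le_lowDegree {h : X.FunField} {β α : ℕ} (hh : X.IsLeadingMonomial h β α) :
    X.remainders h ≤ X.lowDegree ((a * β + b * α : ℕ) + 2 * (X.genus : ℤ) - 1) := by
  rw [remainders_eq hP hh]
  refine Submodule.span_le.2 ?_
  rintro _ ⟨u, v, h1, h2, h3, rfl⟩
  refine X.monomial_mem_lowDegree h2 ?_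
  rw [X.two_mul_genus_int]
  have ha := X.a_pos
  have hb := X.b_pos
  push_cast
  rw [not_and_or, not_le, not_le] at h3
  rcases h3 with h3 | h3
  · have e1 : a * (u + 1) ≤ a * β := Nat.mul_le_mul_left _ h3
    have e2 : b * (v + 1) ≤ b * a := Nat.mul_le_mul_left _ h2
    have e3 : 0 ≤ b * α := Nat.zero_le _
    zify at e1 e2 e3
    linarith
  · have e1 : a * (u + 1) ≤ a * (β + b) := Nat.mul_le_mul_left _ h1
    have e2 : b * (v + 1) ≤ b * α := Nat.mul_le_mul_left _ h3
    zify at e1 e2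
    linarith

include hP in
-- The exponents fill a (β + b) × a rectangle with a b × (a - α) corner removed, which leaves aβ +
-- bα of them.
theorem exists_finset_remainders {h : X.FunField} {β α : ℕ} (hh : X.IsLeadingMonomial h β α) :
    ∃ s : Finset X.FunField, X.remainders h = Submodule.span L s ∧
      s.card ≤ a * β + b * α := by
  classical
  let T : Finset (ℕ × ℕ) := (Finset.range (β + b) ×ˢ Finset.range a) \
    (Finset.Ico β (β + b) ×ˢ Finset.Ico α a)
  refine ⟨T.image fun p => X.x ^ p.1 * X.y ^ p.2, ?_, Finset.card_image_le.trans ?_⟩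
  · rw [remainders_eq hP hh]
    congr 1
    ext f
    simp only [T, Finset.coe_image, Set.mem_image, Finset.mem_coe, Finset.mem_sdiff,
      Finset.mem_product, Finset.mem_range, Finset.mem_Ico, Set.mem_ofPred_eq, Prod.exists]
    constructor
    · rintro ⟨u, v, h1, h2, h3, rfl⟩
      exact ⟨u, v, ⟨⟨h1, h2⟩, fun h4 => h3 ⟨h4.1.1, h4.2.1⟩⟩, rfl⟩
    · rintro ⟨u, v, ⟨⟨h1, h2⟩, h3⟩, rfl⟩
      exact ⟨u, v, h1, h2, fun h4 => h3 ⟨⟨h4.1, h1⟩, h4.2, h2⟩, rfl⟩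
  · have hsub : Finset.Ico β (β + b) ×ˢ Finset.Ico α a ⊆
        Finset.range (β + b) ×ˢ Finset.range a := by
      refine Finset.product_subset_product ?_ ?_
      · exact fun i hi => Finset.mem_range.2 (Finset.mem_Ico.1 hi).2
      · exact fun i hi => Finset.mem_range.2 (Finset.mem_Ico.1 hi).2
    rw [Finset.card_sdiff_of_subset hsub, Finset.card_product, Finset.card_product,
      Finset.card_range, Finset.card_range, Nat.card_Ico, Nat.card_Ico, Nat.add_sub_cancel_left]
    obtain ⟨t, rfl⟩ := Nat.exists_eq_add_of_lt hh.1
    rw [show α + t + 1 - α = t + 1 by omega, Nat.sub_le_iff_le_add]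
    apply le_of_eq
    ring

include hP in
theorem finiteDimensional_remainders {h : X.FunField} {β α : ℕ} (hh : X.IsLeadingMonomial h β α) :
    FiniteDimensional L (X.remainders h) := by
  obtain ⟨s, hs, -⟩ := exists_finset_remainders hP hh
  rw [hs]
  infer_instance

include hP in
theorem finrank_remainders_le {h : X.FunField} {β α : ℕ} (hh : X.IsLeadingMonomial h β α) :
    Module.finrank L (X.remainders h) ≤ a * β + b * α := by
  obtain ⟨s, hs, hc⟩ := exists_finset_remainders hP hh
  rw [hs]
  exact (finrank_span_finset_le_card s).trans hc

end Division

end CabCurve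

/-! ### Dimensions of evaluation codes -/

section Evaluation

variable {L F : Type*} [Field L] [Field F] [Algebra L F]

/-- The graph of the evaluation of functions at `Pts`. -/
noncomputable def evalGraph (Pts : Finset (Place L F)) (V : Submodule L F) :
    Submodule L (F × (Pts → L)) where
  carrier := {x | x.1 ∈ V ∧ ∀ P : Pts, P.1.HasValue x.1 (x.2 P)}
  add_mem' hx hy := ⟨V.add_mem hx.1 hy.1, fun P => (hx.2 P).add (hy.2 P)⟩
  zero_mem' := ⟨V.zero_mem, fun P => Place.HasValue.zero P.1⟩
  smul_mem' r x hx := ⟨V.smul_mem r hx.1, fun P => by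
    have h := (Place.HasValue.const P.1 r).mul (hx.2 P)
    rwa [← Algebra.smul_def] at h⟩

/-- Values are a relation rather than a map, so dimensions are compared through its graph:
uniqueness of values makes the projection to `V` injective, and the other projection has the code as
image. -/
theorem finrank_evalCode_le (Pts : Finset (Place L F)) (V : Submodule L F)
    [FiniteDimensional L V] : Module.finrank L (evalCode Pts V) ≤ Module.finrank L V := by
  let φ : evalGraph Pts V →ₗ[L] V :=
    ((LinearMap.fst L F (Pts → L)).comp (evalGraph Pts V).subtype).codRestrict V fun x => x.2.1
  have hφ : Function.Injective φ := by
    rw [injective_iff_map_eq_zero]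
    rintro ⟨⟨f, c⟩, hf, hc⟩ h
    have hf0 : f = 0 := congrArg Subtype.val h
    subst hf0
    have : c = 0 := funext fun P => (hc P).unique (Place.HasValue.zero P.1)
    subst this
    rfl
  have : FiniteDimensional L (evalGraph Pts V) := FiniteDimensional.of_injective φ hφ
  have h1 := LinearMap.finrank_le_finrank_of_injective hφ
  have h2 : evalCode Pts V = (evalGraph Pts V).map (LinearMap.snd L F (Pts → L)) := by
    ext c
    constructor
    · rintro ⟨f, hf, hc⟩
      exact ⟨(f, c), ⟨hf, hc⟩, rfl⟩
    · rintro ⟨⟨f, c⟩, ⟨hf, hc⟩, rfl⟩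
      exact ⟨f, hf, hc⟩
  rw [h2]
  exact (Submodule.finrank_map_le _ _).trans h1

theorem le_finrank_evalCode (Pts : Finset (Place L F)) (V : Submodule L F)
    (hV : ∀ f ∈ V, ∃ c : Pts → L, ∀ P : Pts, P.1.HasValue f (c P))
    (hinj : ∀ f ∈ V, (∀ P : Pts, P.1.HasValue f 0) → f = 0) :
    Module.finrank L V ≤ Module.finrank L (evalCode Pts V) := by
  let ψ : evalGraph Pts V →ₗ[L] evalCode Pts V :=
    ((LinearMap.snd L F (Pts → L)).comp (evalGraph Pts V).subtype).codRestrict _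
      fun x => ⟨x.1.1, x.2.1, x.2.2⟩
  have hψ : Function.Injective ψ := by
    rw [injective_iff_map_eq_zero]
    rintro ⟨⟨f, c⟩, hf, hc⟩ h
    have hc0 : c = 0 := congrArg Subtype.val h
    subst hc0
    have : f = 0 := hinj f hf hc
    subst this
    rfl
  have : FiniteDimensional L (evalGraph Pts V) := FiniteDimensional.of_injective ψ hψ
  have h1 := LinearMap.finrank_le_finrank_of_injective hψ
  have h2 : V = (evalGraph Pts V).map (LinearMap.fst L F (Pts → L)) := by
    ext f
    constructor
    · intro hf
      obtain ⟨c, hc⟩ := hV f hf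
      exact ⟨(f, c), ⟨hf, hc⟩, rfl⟩
    · rintro ⟨⟨f, c⟩, ⟨hf, hc⟩, rfl⟩
      exact hf
  have h3 : Module.finrank L V ≤ Module.finrank L (evalGraph Pts V) := by
    conv_lhs => rw [h2]
    exact Submodule.finrank_map_le _ _
  exact h3.trans h1

end Evaluation

/-! ### Rational zeros of functions -/

namespace CabCurve

variable {L : Type*} [Field L] {a b : ℕ} {X : CabCurve L a b}
variable {P : Place L X.FunField} (hP : X.IsAtInfinity P)

include hP in
/-- The functions regular on the affine curve separate rational places. -/
theorem exists_separating {Q Q' : Place L X.FunField} (hQ : ¬ X.IsAtInfinity Q)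
    (hQ' : ¬ X.IsAtInfinity Q') (hrat : Q'.IsRational) (hne : Q ≠ Q') :
    ∃ f ∈ X.affine, Q.val f < 1 ∧ ¬ Q'.val f < 1 := by
  by_contra! H
  have hreg : ∀ {R : Place L X.FunField}, ¬ X.IsAtInfinity R →
      ∀ u : X.CoordRing, R.val (algebraMap _ X.FunField u) ≤ 1 := fun hR u =>
    val_le_one_of_mem_affine hR (X.algebraMap_mem_affine u)
  let I : Ideal X.CoordRing :=
    { carrier := {u | Q'.val (algebraMap _ X.FunField u) < 1}
      add_mem' := fun hu hv => by
        change Q'.val _ < 1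
        rw [map_add]
        exact Q'.val.map_add_lt hu hv
      zero_mem' := by
        change Q'.val _ < 1
        rw [map_zero, map_zero]
        exact zero_lt_one
      smul_mem' := fun c u hu => by
        change Q'.val _ < 1
        rw [smul_eq_mul, map_mul, map_mul]
        exact mul_lt_of_le_one_of_lt (hreg hQ' c) hu }
  have hI : ∀ u, u ∈ I ↔ Q'.val (algebraMap _ X.FunField u) < 1 := fun _ => Iff.rfl
  -- Rationality of Q' means that constants represent all residues modulo its center I; hence I is
  -- maximal.
  have hconst : ∀ u : X.CoordRing, ∃ c : L, u - algebraMap L X.CoordRing c ∈ I := by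
    intro u
    obtain ⟨c, hc⟩ := hrat.exists_hasValue (hreg hQ' u)
    refine ⟨c, ?_⟩
    rw [hI, map_sub, ← IsScalarTower.algebraMap_apply]
    exact hc
  have hmax : I.IsMaximal := by
    rw [Ideal.isMaximal_iff]
    refine ⟨?_, fun J u hIJ hu huJ => ?_⟩
    · rw [hI, map_one, map_one]
      exact lt_irrefl _
    · obtain ⟨c, hc⟩ := hconst u
      have hc0 : c ≠ 0 := by
        rintro rfl
        rw [map_zero, sub_zero] at hc
        exact hu hc
      have h1 : algebraMap L X.CoordRing c ∈ J := by
        have := J.sub_mem huJ (hIJ hc)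
        rwa [sub_sub_cancel] at this
      have h2 := J.mul_mem_left (algebraMap L X.CoordRing c⁻¹) h1
      rwa [← map_mul, inv_mul_cancel₀ hc0, map_one] at h2
  -- Otherwise x would be constant, although it has a pole at infinity.
  have hbot : I ≠ ⊥ := by
    intro hbot
    obtain ⟨c, hc⟩ := hconst (Ideal.Quotient.mk _ (MvPolynomial.X 0))
    rw [hbot, Ideal.mem_bot, sub_eq_zero] at hc
    have hx : X.x = algebraMap L X.FunField c := by
      rw [x, hc, ← IsScalarTower.algebraMap_apply]
    have h1 := P.val_algebraMap_le_one c
    rw [← hx, (val_x_y_eq hP).1, ← WithZero.exp_zero, WithZero.exp_le_exp] at h1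
    have := X.a_pos
    omega
  exact hne (X.eq_of_center_eq I hbot
    (fun u hu => H _ (X.algebraMap_mem_affine u) hu) (hreg hQ) (fun u hu => hu) (hreg hQ'))

include hP in
theorem exists_indicator (Pts : Finset (Place L X.FunField))
    (hfin : ∀ Q ∈ Pts, ¬ X.IsAtInfinity Q) (hrat : ∀ Q ∈ Pts, Q.IsRational) {Q : Place L X.FunField}
    (hQ : Q ∈ Pts) : ∃ f ∈ X.affine, ¬ Q.val f < 1 ∧ ∀ R ∈ Pts, R ≠ Q → R.val f < 1 := by
  classical
  have h : ∀ R ∈ Pts.erase Q, ∃ f ∈ X.affine, R.val f < 1 ∧ ¬ Q.val f < 1 := fun R hR =>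
    exists_separating hP (hfin R (Finset.mem_of_mem_erase hR)) (hfin Q hQ) (hrat Q hQ)
      (Finset.ne_of_mem_erase hR)
  choose! F hF h1 h2 using h
  refine ⟨∏ R ∈ Pts.erase Q, F R, X.affine.prod_mem hF, ?_, ?_⟩
  · rw [map_prod, not_lt]
    exact Finset.one_le_prod' fun R hR => not_lt.1 (h2 R hR)
  · intro R hR hne
    have hmem : R ∈ Pts.erase Q := Finset.mem_erase.2 ⟨hne, hR⟩
    rw [← Finset.mul_prod_erase _ _ hmem, map_mul]
    refine mul_lt_of_lt_of_le_one (h1 R hmem) (val_le_one_of_mem_affine (hfin R hR) ?_)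
    exact X.affine.prod_mem fun S hS => hF S (Finset.mem_of_mem_erase hS)

include hP in
/-- A function that is regular on the affine curve has at most as many rational zeros as its
degree. -/
theorem card_zeros_le (Pts : Finset (Place L X.FunField))
    (hfin : ∀ Q ∈ Pts, ¬ X.IsAtInfinity Q) (hrat : ∀ Q ∈ Pts, Q.IsRational)
    {f : X.FunField} {β α : ℕ} (hf : X.IsLeadingMonomial f β α) (hzero : ∀ Q ∈ Pts, Q.val f < 1) :
    Pts.card ≤ a * β + b * α := by
  classical
  have := finiteDimensional_remainders hP hf
  -- As f vanishes on `Pts`, a regular function and its remainder modulo f agree there. So the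
  -- remainders already take all value vectors, and the number of points is at most dim 𝓡(f).
  have htop : evalCode Pts (X.remainders f) = ⊤ := by
    rw [eq_top_iff, ← (Pi.basisFun L Pts).span_eq, Submodule.span_le]
    rintro _ ⟨Q, rfl⟩
    obtain ⟨h, hh, hQ, hR⟩ := exists_indicator hP Pts hfin hrat Q.2
    obtain ⟨n, hn⟩ := X.exists_mem_lowDegree hh
    obtain ⟨r, hr, w, hw, -, e⟩ := exists_division hP hf hn
    have hval : ∀ R ∈ Pts, R.val (f * w) < 1 := fun R hR => by
      rw [map_mul]
      exact mul_lt_of_lt_of_le_one (hzero R hR) (val_le_one_of_mem_affine (hfin R hR) hw)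
    have hr' : r = h - f * w := by rw [e, add_sub_cancel_right]
    obtain ⟨c, hc⟩ := (hrat Q.1 Q.2).exists_hasValue (f := r)
      (val_le_one_of_mem_affine (hfin Q.1 Q.2) (X.lowDegree_le_affine _ hr.2))
    have hc0 : c ≠ 0 := by
      rw [Ne, hc.eq_zero_iff]
      intro hlt
      rw [e] at hQ
      exact hQ (Q.1.val.map_add_lt hlt (hval Q.1 Q.2))
    refine ⟨c⁻¹ • r, Submodule.smul_mem _ _ hr.1, fun R => ?_⟩
    rw [Algebra.smul_def]
    by_cases hRQ : R = Q
    · subst hRQ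
      have h1 := (Place.HasValue.const R.1 c⁻¹).mul hc
      rw [inv_mul_cancel₀ hc0] at h1
      simpa using h1
    · have h0 : R.1.HasValue r 0 := by
        rw [Place.HasValue, map_zero, sub_zero, hr']
        exact R.1.val.map_sub_lt (hR R.1 R.2 fun h => hRQ (Subtype.ext h)) (hval R.1 R.2)
      have h1 := (Place.HasValue.const R.1 c⁻¹).mul h0
      rw [mul_zero] at h1
      simpa [Pi.single_apply, hRQ] using h1
  have h1 := finrank_evalCode_le Pts (X.remainders f)
  rw [htop, finrank_top, Module.finrank_fintype_fun_eq_card, Fintype.card_coe] at h1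
  exact h1.trans (finrank_remainders_le hP hf)

end CabCurve

/-! ### Counting monomials: the Riemann–Roch dimension -/

section Counting

/-- Since b is invertible modulo a, n - bj runs through every residue once. -/
theorem sum_emod_eq {a b : ℕ} (ha : 0 < a) (hab : Nat.Coprime a b) (n : ℤ) :
    ∑ j ∈ Finset.range a, (n - b * j) % a = ∑ j ∈ Finset.range a, (j : ℤ) := by
  classical
  have ha' : (a : ℤ) ≠ 0 := by exact_mod_cast ha.ne'
  have hinj : Set.InjOn (fun j : ℕ => ((n - b * j) % a).toNat) (Finset.range a) := by
    intro j hj j' hj' h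
    have h0 := Int.emod_nonneg (n - b * j) ha'
    have h0' := Int.emod_nonneg (n - b * j') ha'
    have h1 : (n - b * j) % a = (n - b * j') % a := by
      simp only at h
      omega
    have h2 : (a : ℤ) ∣ b * ((j : ℤ) - j') := by
      have := Int.ModEq.dvd h1
      have e : n - b * j' - (n - b * j) = b * ((j : ℤ) - j') := by ring
      rwa [e] at this
    have h3 := (Nat.isCoprime_iff_coprime.2 hab).dvd_of_dvd_mul_left h2
    simp only [Finset.coe_range, Set.mem_Iio] at hj hj'
    have h4 := Int.eq_zero_of_abs_lt_dvd h3 (by rw [abs_lt]; omega)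
    omega
  have himg : (Finset.range a).image (fun j : ℕ => ((n - b * j) % a).toNat) = Finset.range a := by
    refine Finset.eq_of_subset_of_card_le ?_ ?_
    · intro r hr
      obtain ⟨j, -, rfl⟩ := Finset.mem_image.1 hr
      have h0 := Int.emod_nonneg (n - b * j) ha'
      have h1 := Int.emod_lt_of_pos (n - b * j) (by exact_mod_cast ha : (0 : ℤ) < a)
      rw [Finset.mem_range]
      omega
    · rw [Finset.card_image_of_injOn hinj]
  conv_rhs => rw [← himg, Finset.sum_image hinj]
  refine Finset.sum_congr rfl fun j _ => ?_
  rw [Int.toNat_of_nonneg (Int.emod_nonneg _ ha')]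

/-- The number of pairs `(i, j)` with `j < a` and `a i + b j ≤ n`, for `n ≥ a b - a - b`. -/
theorem two_mul_sum_ediv {a b : ℕ} (ha : 0 < a) (hab : Nat.Coprime a b) {n : ℤ}
    (hn : (a : ℤ) * b - a - b ≤ n) :
    2 * ∑ j ∈ Finset.range a, (((n - b * j) / a + 1).toNat : ℤ) =
      2 * n + 2 - ((a : ℤ) - 1) * (b - 1) := by
  have ha' : (0 : ℤ) < a := by exact_mod_cast ha
  have h1 : ∀ j ∈ Finset.range a, (a : ℤ) * (((n - b * j) / a + 1).toNat : ℤ) =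
      n - b * j - (n - b * j) % a + a := by
    intro j hj
    rw [Finset.mem_range] at hj
    -- The lower bound on n makes each summand nonnegative before `Int.toNat`, so nothing is
    -- truncated.
    have h2 : -1 ≤ (n - b * j) / (a : ℤ) := by
      rw [Int.le_ediv_iff_mul_le ha']
      have : b * (j + 1) ≤ b * a := Nat.mul_le_mul_left _ hj
      zify at this
      linarith
    rw [Int.toNat_of_nonneg (by omega)]
    have := Int.mul_ediv_add_emod (n - b * j) a
    linarith
  have h2 : (a : ℤ) * ∑ j ∈ Finset.range a, (((n - b * j) / a + 1).toNat : ℤ) =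
      a * n - b * ∑ j ∈ Finset.range a, (j : ℤ) - ∑ j ∈ Finset.range a, (j : ℤ) + a * a := by
    rw [Finset.mul_sum, Finset.sum_congr rfl h1, Finset.sum_add_distrib, Finset.sum_sub_distrib,
      Finset.sum_sub_distrib, sum_emod_eq ha hab, Finset.mul_sum]
    simp
  have h3 : (∑ j ∈ Finset.range a, (j : ℤ)) * 2 = a * (a - 1) := by
    have := Finset.sum_range_id_mul_two a
    zify [ha] at this
    simpa using this
  apply mul_left_cancel₀ ha'.ne'
  linear_combination 2 * h2 - (b + 1) * h3

end Counting

namespace CabCurve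

variable {L : Type*} [Field L] {a b : ℕ} {X : CabCurve L a b}

/-- The exponents of the monomials `x^i y^j`, `j < a`, of weighted degree at most `n`. -/
def exponents (a b : ℕ) (n : ℤ) : Finset (Σ _ : ℕ, ℕ) :=
  (Finset.range a).sigma fun j => Finset.range ((n - b * j) / a + 1).toNat

theorem mem_exponents (ha : 0 < a) {n : ℤ} {p : Σ _ : ℕ, ℕ} :
    p ∈ exponents a b n ↔ p.1 < a ∧ ((a * p.2 + b * p.1 : ℕ) : ℤ) ≤ n := by
  have ha' : (0 : ℤ) < a := by exact_mod_cast ha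
  rw [exponents, Finset.mem_sigma, Finset.mem_range, Finset.mem_range]
  refine and_congr_right fun _ => ?_
  rw [Int.lt_toNat, Int.lt_add_one_iff, Int.le_ediv_iff_mul_le ha']
  push_cast
  constructor <;> intro h <;> linarith

theorem lowDegree_eq_span_image (n : ℤ) : X.lowDegree n =
    Submodule.span L ((fun p : Σ _ : ℕ, ℕ => X.x ^ p.2 * X.y ^ p.1) '' (exponents a b n)) := by
  rw [lowDegree]
  congr 1
  ext f
  constructor
  · rintro ⟨i, j, hj, hn, rfl⟩
    exact ⟨⟨j, i⟩, (mem_exponents X.a_pos).2 ⟨hj, hn⟩, rfl⟩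
  · rintro ⟨⟨j, i⟩, h, rfl⟩
    obtain ⟨hj, hn⟩ := (mem_exponents X.a_pos).1 h
    exact ⟨i, j, hj, hn, rfl⟩

instance finiteDimensional_lowDegree (n : ℤ) : FiniteDimensional L (X.lowDegree n) := by
  rw [lowDegree_eq_span_image]
  exact FiniteDimensional.span_of_finite L ((exponents a b n).finite_toSet.image _)

theorem linearIndepOn_monomials {P : Place L X.FunField} (hP : X.IsAtInfinity P) (n : ℤ) :
    LinearIndepOn L (fun p : Σ _ : ℕ, ℕ => X.x ^ p.2 * X.y ^ p.1) (exponents a b n : Set _) := by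
  classical
  rw [linearIndepOn_finset_iff]
  intro c hc
  by_contra! H
  obtain ⟨p₀, hp₀, hc₀⟩ := H
  obtain ⟨p, hp, hmax⟩ := Finset.exists_max_image
    ((exponents a b n).filter fun p => c p ≠ 0) (fun p => a * p.2 + b * p.1)
    ⟨p₀, Finset.mem_filter.2 ⟨hp₀, hc₀⟩⟩
  obtain ⟨hpS, hcp⟩ := Finset.mem_filter.1 hp
  obtain ⟨hpa, -⟩ := (mem_exponents X.a_pos).1 hpS
  -- A nontrivial relation would give the zero function a leading monomial, hence a nonzero
  -- valuation at infinity.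
  have hlead : X.IsLeadingMonomial (0 : X.FunField) p.2 p.1 := by
    refine X.isLeadingMonomial_iff.2 ⟨hpa, c p, hcp, ?_⟩
    rw [← hc, ← Finset.add_sum_erase _ _ hpS, add_sub_cancel_left]
    refine Submodule.sum_mem _ fun p' hp' => ?_
    obtain ⟨hne, hp'S⟩ := Finset.mem_erase.1 hp'
    by_cases hc' : c p' = 0
    · rw [hc', zero_smul]
      exact Submodule.zero_mem _
    · obtain ⟨hpa', -⟩ := (mem_exponents X.a_pos).1 hp'S
      have hle := hmax p' (Finset.mem_filter.2 ⟨hp'S, hc'⟩)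
      have hlt : a * p'.2 + b * p'.1 ≠ a * p.2 + b * p.1 := by
        intro h
        obtain ⟨h1, h2⟩ := X.weight_injective hpa' hpa h
        exact hne (by cases p; cases p'; simp_all)
      exact Submodule.smul_mem _ _ (X.monomial_mem_lowDegree hpa' (by omega))
  have := val_of_isLeadingMonomial hP hlead
  rw [map_zero] at this
  exact WithZero.exp_ne_zero this.symm

/-- The dimension of the Riemann–Roch space of `n · P∞` for `n ≥ 2 g - 1`. -/
theorem finrank_lowDegree {P : Place L X.FunField} (hP : X.IsAtInfinity P) {n : ℤ}
    (hn : 2 * (X.genus : ℤ) - 1 ≤ n) :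
    (Module.finrank L (X.lowDegree n) : ℤ) = n + 1 - X.genus := by
  have hg := X.two_mul_genus_int
  have h1 : Module.finrank L (X.lowDegree n) = (exponents a b n).card := by
    rw [lowDegree_eq_span_image, Set.image_eq_range]
    exact (finrank_span_eq_card (linearIndepOn_monomials hP n)).trans (Fintype.card_coe _)
  have h2 := two_mul_sum_ediv X.a_pos X.coprime (n := n) (by linarith)
  rw [h1, exponents, Finset.card_sigma]
  push_cast
  simp only [Finset.card_range]
  linarith

end CabCurve

/-! ### The trace codes: reduction to remainders and nesting -/

section TraceCodes

variable {K L F : Type*} [Field K] [Field L] [Algebra K L] [Field F] [Algebra L F]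

theorem mem_traceCode_evalCode_map {Pts : Finset (Place L F)} {V : Submodule L F} {u : F}
    {x : Pts → K} : x ∈ traceCode K (evalCode Pts (V.map (LinearMap.mulLeft L u))) ↔
      ∃ f ∈ V, ∃ c : Pts → L, (∀ P : Pts, P.1.HasValue (u * f) (c P)) ∧ traceVec K c = x := by
  constructor
  · rintro ⟨c, ⟨_, ⟨f, hf, rfl⟩, hc⟩, rfl⟩
    exact ⟨f, hf, c, hc, rfl⟩
  · rintro ⟨f, hf, c, hc, rfl⟩
    exact ⟨c, ⟨_, ⟨f, hf, rfl⟩, hc⟩, rfl⟩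

end TraceCodes

namespace CabCurve

variable {L : Type*} [Field L] {a b : ℕ} {X : CabCurve L a b}
variable {P : Place L X.FunField} (hP : X.IsAtInfinity P)

include hP in
theorem mem_lowDegree_of_mul_mem {h w : X.FunField} {d n : ℤ} (hh : P.val h = WithZero.exp d)
    (hw : w ∈ X.affine) (hhw : h * w ∈ X.lowDegree n) : w ∈ X.lowDegree (n - d) := by
  refine (mem_lowDegree_iff hP).2 ⟨hw, ?_⟩
  have h1 := val_le_of_mem_lowDegree hP hhw
  rw [map_mul, hh] at h1
  rw [WithZero.exp_sub, le_div_iff₀ WithZero.exp_pos, mul_comm]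
  exact h1

include hP in
theorem mul_mem_lowDegree {f h : X.FunField} {n n' : ℤ} (hf : f ∈ X.lowDegree n)
    (hh : h ∈ X.lowDegree n') : f * h ∈ X.lowDegree (n + n') := by
  rw [mem_lowDegree_iff hP] at hf hh ⊢
  refine ⟨X.affine.mul_mem hf.1 hh.1, ?_⟩
  rw [map_mul, WithZero.exp_add]
  exact mul_le_mul' hf.2 hh.2

include hP in
theorem pow_mem_lowDegree {f : X.FunField} {n : ℤ} (hf : f ∈ X.lowDegree n) (t : ℕ) :
    f ^ t ∈ X.lowDegree (t * n) := by
  rw [mem_lowDegree_iff hP] at hf ⊢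
  refine ⟨X.affine.pow_mem hf.1 t, ?_⟩
  rw [map_pow, ← nsmul_eq_mul, WithZero.exp_nsmul]
  exact pow_le_pow_left' hf.2 t

include hP in
theorem exists_isLeadingMonomial_pow {g : X.FunField} {d : ℤ} (hgA : g ∈ X.affine)
    (hgd : P.val g = WithZero.exp d) (t : ℕ) :
    ∃ β α, X.IsLeadingMonomial (g ^ t) β α ∧ ((a * β + b * α : ℕ) : ℤ) = t * d := by
  have hval : P.val (g ^ t) = WithZero.exp (t * d) := by
    rw [map_pow, hgd, ← WithZero.exp_nsmul, nsmul_eq_mul]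
  have h0 : g ^ t ≠ 0 := by
    intro h
    rw [h, map_zero] at hval
    exact WithZero.exp_ne_zero hval.symm
  obtain ⟨β, α, h⟩ := exists_isLeadingMonomial (X.affine.pow_mem hgA t) h0
  refine ⟨β, α, h, ?_⟩
  rw [val_of_isLeadingMonomial hP h, WithZero.exp_inj] at hval
  exact hval

theorem mem_riemannRoch_add_principalDivisor_iff {g : X.FunField} (hg0 : g ≠ 0) {D : Place L X.FunField → ℤ}
    {f : X.FunField} : f ∈ riemannRoch (D + principalDivisor L g) ↔ g * f ∈ riemannRoch D := by
  refine forall_congr' fun Q => ?_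
  rw [map_mul, Q.val_eq_exp_neg_ord hg0, Pi.add_apply, principalDivisor, WithZero.exp_neg,
    WithZero.exp_add, inv_mul_le_iff₀ WithZero.exp_pos, mul_comm]

include hP in
theorem onePointCode_eq {g : X.FunField} (hg0 : g ≠ 0) (Pts : Finset (Place L X.FunField)) (s : ℤ) :
    X.onePointCode P Pts s g =
      evalCode Pts ((X.lowDegree s).map (LinearMap.mulLeft L g⁻¹)) := by
  rw [onePointCode, agCode]
  congr 1
  ext f
  rw [mem_riemannRoch_add_principalDivisor_iff hg0, riemannRoch_divisor_eq hP]
  constructor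
  · intro h
    exact ⟨g * f, h, inv_mul_cancel_left₀ hg0 f⟩
  · rintro ⟨h, hh, rfl⟩
    rw [LinearMap.mulLeft_apply, mul_inv_cancel_left₀ hg0]
    exact hh

include hP in
theorem onePointCode_eq_bot {g : X.FunField} (hg0 : g ≠ 0) (Pts : Finset (Place L X.FunField))
    {s : ℤ} (hs : s < 0) : X.onePointCode P Pts s g = ⊥ := by
  rw [onePointCode_eq hP hg0, X.lowDegree_of_neg hs, Submodule.map_bot, eq_bot_iff]
  rintro c ⟨f, hf, hc⟩
  rw [Submodule.mem_bot] at hf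
  subst hf
  exact funext fun Q => (hc Q).unique (Place.HasValue.zero Q.1)

theorem exists_values {Pts : Finset (Place L X.FunField)} (hfin : ∀ Q ∈ Pts, ¬ X.IsAtInfinity Q)
    (hrat : ∀ Q ∈ Pts, Q.IsRational) {g : X.FunField} (hgv : ∀ Q ∈ Pts, Q.val g = 1)
    {f : X.FunField} (hf : f ∈ X.affine) (t : ℕ) :
    ∃ c : Pts → L, ∀ Q : Pts, Q.1.HasValue ((g ^ t)⁻¹ * f) (c Q) := by
  have h : ∀ Q : Pts, ∃ c, Q.1.HasValue ((g ^ t)⁻¹ * f) c := fun Q => by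
    refine (hrat Q.1 Q.2).exists_hasValue ?_
    rw [map_mul, map_inv₀, map_pow, hgv Q.1 Q.2, one_pow, inv_one, one_mul]
    exact val_le_one_of_mem_affine (hfin Q.1 Q.2) hf
  choose c hc using h
  exact ⟨c, hc⟩

variable (K : Type*) [Field K] [Algebra K L]

/-- The trace code of `g^{-(q^i+1)} 𝓛(s (q^i+1) P∞)`, with `q = |K|`. -/
noncomputable def fullTrace (X : CabCurve L a b) (Pts : Finset (Place L X.FunField)) (s : ℤ)
    (g : X.FunField) (i : ℕ) : Submodule K (Pts → K) :=
  traceCode K (evalCode Pts ((X.lowDegree (s * ((Nat.card K : ℤ) ^ i + 1))).map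
    (LinearMap.mulLeft L (g ^ (Nat.card K ^ i + 1))⁻¹)))

variable {K} [Finite K]

theorem two_le_natCard : 2 ≤ Nat.card K := Finite.one_lt_card

omit [Finite K] in
include hP in
theorem twistedSquare_onePointCode_le [Finite L] {g : X.FunField} (hg0 : g ≠ 0)
    (Pts : Finset (Place L X.FunField)) (s : ℤ) (i : ℕ) :
    twistedSquare K (X.onePointCode P Pts s g) i ≤ X.fullTrace K Pts s g i := by
  rw [onePointCode_eq hP hg0]
  refine Submodule.span_le.2 ?_
  rintro _ ⟨c, ⟨_, ⟨f, hf, rfl⟩, hc⟩, d, ⟨_, ⟨h, hh, rfl⟩, hd⟩, rfl⟩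
  refine mem_traceCode_evalCode_map.2 ⟨f * h ^ Nat.card K ^ i, ?_, _, fun Q => ?_, rfl⟩
  · have := mul_mem_lowDegree hP hf (pow_mem_lowDegree hP hh (Nat.card K ^ i))
    refine X.lowDegree_mono (le_of_eq ?_) this
    push_cast
    ring
  · have h1 := (hc Q).mul ((hd Q).pow (Nat.card K ^ i))
    have e : LinearMap.mulLeft L g⁻¹ f * (LinearMap.mulLeft L g⁻¹ h) ^ Nat.card K ^ i =
        (g ^ (Nat.card K ^ i + 1))⁻¹ * (f * h ^ Nat.card K ^ i) := by
      rw [LinearMap.mulLeft_apply, LinearMap.mulLeft_apply, mul_pow, pow_succ, mul_inv, inv_pow]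
      ring
    rw [e] at h1
    exact h1

section Affine

variable [Finite L] {g : X.FunField} {s s' : ℤ} (hss' : s < s') (hgA : g ∈ X.affine)
  (hgd : P.val g = WithZero.exp s')
  {Pts : Finset (Place L X.FunField)} (hfin : ∀ Q ∈ Pts, ¬ X.IsAtInfinity Q)
  (hrat : ∀ Q ∈ Pts, Q.IsRational) (hgv : ∀ Q ∈ Pts, Q.val g = 1)

omit [Finite L] in
include hgd in
theorem ne_zero_of_val_eq_exp : g ≠ 0 := by
  rintro rfl
  rw [map_zero] at hgd
  exact WithZero.exp_ne_zero hgd.symm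

omit [Finite L] in
include hP hgA hgd in
theorem mul_pow_mem_lowDegree {w : X.FunField} {n : ℤ} (hw : w ∈ X.lowDegree n) (t : ℕ) :
    g * w ^ t ∈ X.lowDegree (s' + t * n) :=
  mul_mem_lowDegree hP ((mem_lowDegree_iff hP).2 ⟨hgA, hgd.le⟩) (pow_mem_lowDegree hP hw t)

omit [Finite L] in
/-- The Frobenius turns the value vector of `g^{-q^i} w` into that of
`g^{-(q^{i+1}+1)} (g w^q)`. -/
theorem hasValue_frobenius {Q : Place L X.FunField} (hg0 : g ≠ 0) {w : X.FunField} {i q : ℕ} {c : L}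
    (h : Q.HasValue ((g ^ q ^ i)⁻¹ * w) c) :
    Q.HasValue ((g ^ (q ^ (i + 1) + 1))⁻¹ * (g * w ^ q)) (c ^ q) := by
  have h1 := h.pow q
  have e : ((g ^ q ^ i)⁻¹ * w) ^ q = (g ^ (q ^ (i + 1) + 1))⁻¹ * (g * w ^ q) := by
    rw [mul_pow, inv_pow, ← pow_mul, ← pow_succ, pow_succ g, mul_inv, mul_assoc,
      inv_mul_cancel_left₀ hg0]
  rwa [e] at h1

include hP hss' hgA hgd hfin hrat hgv in
-- Descent on the degree of the numerator. Division by h = g^{q^{i+1}-q^i+1} splits off a remainder,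
-- and for the multiple h w the denominator shrinks to g^{q^i}; raising to the q-th power preserves
-- the trace and restores the denominator with the numerator g w^q.
theorem fullTrace_le_traceT (i : ℕ) : X.fullTrace K Pts s g i ≤ X.traceT K P Pts s g i := by
  have hg0 : g ≠ 0 := ne_zero_of_val_eq_exp hgd
  cases i with
  | zero =>
    rw [fullTrace, traceT, numerators, riemannRoch_divisor_eq hP]
    have : s * ((Nat.card K : ℤ) ^ 0 + 1) = 2 * s := by ring
    rw [this]
  | succ i =>
    set q := Nat.card K with hq
    have hq2 : 2 ≤ q := two_le_natCard
    have hqpow : q ^ i ≤ q ^ (i + 1) := Nat.pow_le_pow_right (by omega) (by omega)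
    obtain ⟨β, α, hlead, hdeg⟩ := exists_isLeadingMonomial_pow hP hgA hgd (q ^ (i + 1) - q ^ i + 1)
    have hhd := val_of_isLeadingMonomial hP hlead
    rw [hdeg] at hhd
    suffices H : ∀ N : ℕ, (N : ℤ) - 1 ≤ s * ((q : ℤ) ^ (i + 1) + 1) →
        ∀ f ∈ X.lowDegree ((N : ℤ) - 1), ∀ c : Pts → L,
        (∀ Q : Pts, Q.1.HasValue ((g ^ (q ^ (i + 1) + 1))⁻¹ * f) (c Q)) →
        traceVec K c ∈ X.traceT K P Pts s g (i + 1) by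
      intro x hx
      obtain ⟨f, hf, c, hc, rfl⟩ := mem_traceCode_evalCode_map.1 hx
      rcases lt_or_ge (s * ((q : ℤ) ^ (i + 1) + 1)) 0 with hn | hn
      · rw [X.lowDegree_of_neg hn, Submodule.mem_bot] at hf
        subst hf
        have : c = 0 := funext fun Q => (hc Q).unique (by
          rw [mul_zero]; exact Place.HasValue.zero Q.1)
        rw [this, map_zero]
        exact Submodule.zero_mem _
      · obtain ⟨N, hN⟩ : ∃ N : ℕ, s * ((q : ℤ) ^ (i + 1) + 1) = (N : ℤ) - 1 :=
          ⟨(s * ((q : ℤ) ^ (i + 1) + 1) + 1).toNat, by omega⟩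
        rw [hN] at hf
        exact H N hN.ge f hf c hc
    intro N
    induction N with
    | zero =>
      intro _ f hf c hc
      rw [X.lowDegree_of_neg (by simp), Submodule.mem_bot] at hf
      subst hf
      have : c = 0 := funext fun Q => (hc Q).unique (by
        rw [mul_zero]; exact Place.HasValue.zero Q.1)
      rw [this, map_zero]
      exact Submodule.zero_mem _
    | succ N ih =>
      intro hN f hf c hc
      obtain ⟨r, hr, w, hw, hhw, e⟩ := exists_division hP hlead hf
      have hwl := mem_lowDegree_of_mul_mem hP hhd hw hhw
      obtain ⟨cr, hcr⟩ := exists_values hfin hrat hgv (X.lowDegree_le_affine _ hr.2)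
        (q ^ (i + 1) + 1)
      obtain ⟨d, hd⟩ := exists_values hfin hrat hgv hw (q ^ i)
      have hcd : c = cr + d := funext fun Q => (hc Q).unique (by
        have h1 := (hcr Q).add (hd Q)
        have e1 : (g ^ (q ^ (i + 1) + 1))⁻¹ * r + (g ^ q ^ i)⁻¹ * w =
            (g ^ (q ^ (i + 1) + 1))⁻¹ * f := by
          have e2 : g ^ (q ^ (i + 1) + 1) = g ^ (q ^ (i + 1) - q ^ i + 1) * g ^ q ^ i := by
            rw [← pow_add]; congr 1; omega
          have e3 : g ^ (q ^ (i + 1) - q ^ i + 1) ≠ 0 := pow_ne_zero _ hg0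
          have e4 : (g ^ (q ^ (i + 1) + 1))⁻¹ * (g ^ (q ^ (i + 1) - q ^ i + 1) * w) =
              (g ^ q ^ i)⁻¹ * w := by
            rw [e2, mul_inv_rev, mul_assoc, inv_mul_cancel_left₀ e3]
          rw [e, mul_add, e4]
        rw [e1] at h1
        exact h1)
      rw [hcd, map_add]
      refine Submodule.add_mem _ ?_ ?_
      · refine mem_traceCode_evalCode_map.2 ⟨r, ⟨hr.1, ?_⟩, cr, hcr, rfl⟩
        rw [riemannRoch_divisor_eq hP]
        exact X.lowDegree_mono hN hr.2
      · rw [← traceVec_pow_card_pow d 1, pow_one]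
        refine ih (by push_cast at hN; linarith) (g * w ^ q) ?_ _
          fun Q => hasValue_frobenius hg0 (hd Q)
        -- The new degree s' + q(N - s'(q^{i+1} - q^i + 1)) is below N exactly when N < s'(q^{i+1} +
        -- 1). This holds because N ≤ s(q^{i+1} + 1) and s < s'.
        refine X.lowDegree_mono ?_ (mul_pow_mem_lowDegree hP hgA hgd hwl q)
        have hQ0 : (0 : ℤ) < (q : ℤ) ^ (i + 1) + 1 := by positivity
        have h1 : s * ((q : ℤ) ^ (i + 1) + 1) + 1 ≤ s' * ((q : ℤ) ^ (i + 1) + 1) := by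
          nlinarith
        have h2 : ((N + 1 : ℕ) : ℤ) ≤ s' * ((q : ℤ) ^ (i + 1) + 1) := by linarith
        push_cast [hqpow] at h2 ⊢
        have h3 : (2 : ℤ) ≤ q := by exact_mod_cast hq2
        have h4 : (N + 1) * ((q : ℤ) - 1) ≤ s' * ((q : ℤ) ^ (i + 1) + 1) * ((q : ℤ) - 1) :=
          mul_le_mul_of_nonneg_right h2 (by linarith)
        have h5 : (q : ℤ) ^ (i + 1) = q ^ i * q := pow_succ _ _
        rw [h5] at h4 ⊢
        nlinarith

include hP hss' hgA hgd hfin hrat hgv in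
-- Divide by g: f = r + g u. Multiplying r by g^{q^{i+1}-q^i} adapts it to the next denominator, and
-- its degree, at most s'(q^{i+1} - q^i + 1) + 2γ - 1, fits below s(q^{i+1} + 1) precisely by the
-- hypothesis. The part with u is moved up by Frobenius to g u^q, whose degree fits because s < s'.
theorem fullTrace_le_succ {i : ℕ} (hi : (s' - s) * ((Nat.card K : ℤ) ^ (i + 1) -
      (Nat.card K : ℤ) ^ i + 1) + 2 * (X.genus : ℤ) - 1 ≤ s * (Nat.card K : ℤ) ^ i) :
    X.fullTrace K Pts s g i ≤ X.fullTrace K Pts s g (i + 1) := by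
  have hg0 : g ≠ 0 := ne_zero_of_val_eq_exp hgd
  set q := Nat.card K with hq
  have hq2 : 2 ≤ q := two_le_natCard
  have hqpow : q ^ i ≤ q ^ (i + 1) := Nat.pow_le_pow_right (by omega) (by omega)
  obtain ⟨β, α, hlead, hdeg⟩ := exists_isLeadingMonomial_pow hP hgA hgd 1
  rw [pow_one, Nat.cast_one, one_mul] at *
  intro x hx
  obtain ⟨f, hf, c, hc, rfl⟩ := mem_traceCode_evalCode_map.1 hx
  obtain ⟨r, hr, u, hu, hgu, e⟩ := exists_division hP hlead hf
  have hul := mem_lowDegree_of_mul_mem hP hgd hu hgu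
  have hrl := remainders_le_lowDegree hP hlead hr.1
  rw [hdeg] at hrl
  obtain ⟨cr, hcr⟩ := exists_values hfin hrat hgv (X.lowDegree_le_affine _ hr.2) (q ^ i + 1)
  obtain ⟨d, hd⟩ := exists_values hfin hrat hgv hu (q ^ i)
  have hcd : c = cr + d := funext fun Q => (hc Q).unique (by
    have h1 := (hcr Q).add (hd Q)
    have e1 : (g ^ (q ^ i + 1))⁻¹ * r + (g ^ q ^ i)⁻¹ * u = (g ^ (q ^ i + 1))⁻¹ * f := by
      have e4 : (g ^ (q ^ i + 1))⁻¹ * (g * u) = (g ^ q ^ i)⁻¹ * u := by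
        rw [pow_succ', mul_inv_rev, mul_assoc, inv_mul_cancel_left₀ hg0]
      rw [e, mul_add, e4]
    rw [e1] at h1
    exact h1)
  rw [hcd, map_add]
  refine Submodule.add_mem _ ?_ ?_
  · refine mem_traceCode_evalCode_map.2 ⟨g ^ (q ^ (i + 1) - q ^ i) * r, ?_, cr, fun Q => ?_, rfl⟩
    · refine X.lowDegree_mono ?_ (mul_mem_lowDegree hP (pow_mem_lowDegree hP
        ((mem_lowDegree_iff hP).2 ⟨hgA, hgd.le⟩) (q ^ (i + 1) - q ^ i)) hrl)
      push_cast [hqpow]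
      linarith
    · have e2 : g ^ (q ^ (i + 1) + 1) = g ^ (q ^ (i + 1) - q ^ i) * g ^ (q ^ i + 1) := by
        rw [← pow_add]; congr 1; omega
      have e3 : g ^ (q ^ (i + 1) - q ^ i) ≠ 0 := pow_ne_zero _ hg0
      rw [← hq, e2, mul_inv_rev, mul_assoc, inv_mul_cancel_left₀ e3]
      exact hcr Q
  · rw [← traceVec_pow_card_pow d 1, pow_one]
    refine mem_traceCode_evalCode_map.2 ⟨g * u ^ q, ?_, _,
      fun Q => hasValue_frobenius hg0 (hd Q), rfl⟩
    refine X.lowDegree_mono ?_ (mul_pow_mem_lowDegree hP hgA hgd hul q)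
    have h3 : (2 : ℤ) ≤ q := by exact_mod_cast hq2
    rw [← hq]
    have h5 : (q : ℤ) ^ (i + 1) = q ^ i * q := pow_succ _ _
    rw [h5]
    nlinarith

omit [Finite K] [Finite L] in
include hP in
theorem traceT_le_fullTrace (i : ℕ) : X.traceT K P Pts s g i ≤ X.fullTrace K Pts s g i := by
  cases i with
  | zero =>
    rw [fullTrace, traceT, numerators, riemannRoch_divisor_eq hP]
    have : s * ((Nat.card K : ℤ) ^ 0 + 1) = 2 * s := by ring
    rw [this]
  | succ i =>
    intro x hx
    obtain ⟨f, hf, c, hc, rfl⟩ := mem_traceCode_evalCode_map.1 hx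
    refine mem_traceCode_evalCode_map.2 ⟨f, ?_, c, hc, rfl⟩
    have := hf.2
    rw [riemannRoch_divisor_eq hP] at this
    exact this

include hP hgA hgd in
theorem finrank_traceT_succ_le (Pts : Finset (Place L X.FunField)) (s : ℤ) (i : ℕ) :
    (Module.finrank K (X.traceT K P Pts s g (i + 1)) : ℤ) ≤
      Module.finrank K L * (s' * ((Nat.card K : ℤ) ^ (i + 1) - (Nat.card K : ℤ) ^ i + 1)) := by
  set q := Nat.card K with hq
  have hq2 : 2 ≤ q := two_le_natCard
  have hqpow : q ^ i ≤ q ^ (i + 1) := Nat.pow_le_pow_right (by omega) (by omega)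
  obtain ⟨β, α, hlead, hdeg⟩ := exists_isLeadingMonomial_pow hP hgA hgd (q ^ (i + 1) - q ^ i + 1)
  have := finiteDimensional_remainders hP hlead
  have h1 := finrank_remainders_le hP hlead
  set V := X.numerators P q s g (i + 1) with hV
  have hle : V ≤ X.remainders (g ^ (q ^ (i + 1) - q ^ i + 1)) := inf_le_left
  have : FiniteDimensional L V := Submodule.finiteDimensional_of_le hle
  have h2 := (Submodule.finrank_mono hle).trans h1
  have h3 := (finrank_evalCode_le Pts (V.map (LinearMap.mulLeft L (g ^ (q ^ (i + 1) + 1))⁻¹))).trans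
    ((Submodule.finrank_map_le _ _).trans h2)
  have h4 := (finrank_traceCode_le (K := K) (evalCode Pts (V.map
    (LinearMap.mulLeft L (g ^ (q ^ (i + 1) + 1))⁻¹)))).trans (Nat.mul_le_mul_left _ h3)
  have h5 : (Module.finrank K (X.traceT K P Pts s g (i + 1)) : ℤ) ≤
      ((Module.finrank K L * (a * β + b * α) : ℕ) : ℤ) := Nat.cast_le.2 h4
  refine h5.trans (le_of_eq ?_)
  rw [Nat.cast_mul, hdeg]
  push_cast [hqpow]
  ring

end Affine

end CabCurve

/-! ### The dimension bounds -/

/-- Arithmetic for e = 0. The available estimates are `h0` (Riemann–Roch for 𝓣_0), `h1` (the bound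
with e = 1, where 𝓣_0 is absorbed by 𝓣_1) and the length n. Either n ≤ s, and the length is small
enough, or k ≥ s + 1 - γ, and the loss in one of the first two estimates can be compared with k². -/
theorem le_bound_of_dichotomy {D n k m q γ : ℕ} {s s' : ℤ} (hm : 2 ≤ m) (hq : 2 ≤ q)
    (hss' : s < s') (hs : (s' - s) * q + 2 * (γ : ℤ) - 1 ≤ s)
    (h0 : (D : ℚ) ≤ ((m : ℚ) - 1) / 2 * m * k ^ 2 + m * (2 * s + 1 - γ))
    (h1 : (D : ℚ) ≤ max (((m : ℚ) - 1) / 2 - 1) 0 * m * k ^ 2 + m * (s' * q))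
    (hD : D ≤ n) (hnk : (n : ℤ) ≤ s ∨ s + 1 - γ ≤ (k : ℤ)) (hγ : γ = 0 → n ≤ q ^ m) :
    (D : ℚ) ≤ ((m : ℚ) - 1) / 2 * m * k ^ 2 + m * s' * (2 - (q : ℚ)⁻¹) := by
  have hq' : (2 : ℚ) ≤ q := by exact_mod_cast hq
  have hm' : (2 : ℚ) ≤ m := by exact_mod_cast hm
  have hqZ : (2 : ℤ) ≤ q := by exact_mod_cast hq
  have hr0 : (0 : ℚ) < (q : ℚ)⁻¹ := by positivity
  have hr : (q : ℚ)⁻¹ ≤ 2⁻¹ := inv_anti₀ (by norm_num) hq'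
  have hqr : (q : ℚ) * (q : ℚ)⁻¹ = 1 := mul_inv_cancel₀ (by positivity)
  have hss : (s : ℚ) + 1 ≤ s' := by exact_mod_cast hss'
  have hs0 : 0 < s' := by nlinarith
  have hs0' : (0 : ℚ) < s' := by exact_mod_cast hs0
  set r := (q : ℚ)⁻¹
  have hk0 : 0 ≤ ((m : ℚ) - 1) / 2 * m * k ^ 2 :=
    mul_nonneg (mul_nonneg (by linarith) (by linarith)) (sq_nonneg _)
  have hD' : (D : ℚ) ≤ n := by exact_mod_cast hD
  rcases hnk with hn | hk
  · have hn' : (n : ℚ) ≤ s := by exact_mod_cast hn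
    have h2 : (s' : ℚ) ≤ m * s' * (2 - r) := by
      have : (1 : ℚ) ≤ m * (2 - r) := by nlinarith
      nlinarith
    linarith
  -- The threshold is where 2s + 1 - γ = s'(2 - 1/q): up to it `h0` suffices, beyond it s' is large
  -- and `h1` is the main tool.
  rcases le_or_gt s' (q * (2 * (s' - s) - 1 + γ)) with hA | hB
  · have hA' : (s' : ℚ) ≤ q * (2 * (s' - s) - 1 + γ) := by exact_mod_cast hA
    have h2 : (s' : ℚ) * r ≤ 2 * (s' - s) - 1 + γ := by
      have := mul_le_mul_of_nonneg_right hA' hr0.le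
      calc _ ≤ _ := this
        _ = (q * r) * (2 * (s' - s) - 1 + γ) := by ring
        _ = _ := by rw [hqr, one_mul]
    have h3 : (m : ℚ) * (2 * s + 1 - γ) ≤ m * (s' * (2 - r)) :=
      mul_le_mul_of_nonneg_left (by linarith) (by linarith)
    linarith
  -- Passing from e = 0 to e = 1 saves c in the coefficient of mk²; this must pay for the excess s'q
  -- - s'(2 - 1/q).
  have hsum : ∀ c : ℚ, max (((m : ℚ) - 1) / 2 - 1) 0 + c ≤ ((m : ℚ) - 1) / 2 →
      (s' : ℚ) * (q - 2 + r) ≤ c * k ^ 2 →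
      (D : ℚ) ≤ ((m : ℚ) - 1) / 2 * m * k ^ 2 + m * s' * (2 - r) := by
    intro c hc h
    have e1 : (max (((m : ℚ) - 1) / 2 - 1) 0 + c) * (m * k ^ 2) ≤
        ((m : ℚ) - 1) / 2 * (m * k ^ 2) := mul_le_mul_of_nonneg_right hc (by positivity)
    have e2 : (m : ℚ) * (s' * (q - 2 + r)) ≤ m * (c * k ^ 2) :=
      mul_le_mul_of_nonneg_left h (by linarith)
    linarith
  have hc2 : max (((m : ℚ) - 1) / 2 - 1) 0 + 1 / 2 ≤ ((m : ℚ) - 1) / 2 := by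
    rcases max_cases (((m : ℚ) - 1) / 2 - 1) 0 with h | h <;> linarith
  have hkQ : (s : ℚ) + 1 - γ ≤ k := by exact_mod_cast hk
  have hsQ : ((s' : ℚ) - s) * q + 2 * γ - 1 ≤ s := by exact_mod_cast hs
  have hBQ : (q : ℚ) * (2 * (s' - s) - 1 + γ) + 1 ≤ s' := by exact_mod_cast hB
  have hγQ : (0 : ℚ) ≤ γ := by positivity
  -- In this boundary case the saving c = 1/2 need not suffice. For m ≥ 3 the saving is c = 1; for m
  -- = 2 the length is at most q² ≤ k², since a curve of genus 0 has few rational points.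
  by_cases hC : s' = s + 1 ∧ γ = 0
  · obtain ⟨hd, rfl⟩ := hC
    have hdQ : (s' : ℚ) = s + 1 := by exact_mod_cast hd
    have hks : (s' : ℚ) ≤ k := by push_cast at hkQ; linarith
    have hqs : (q : ℚ) + 1 ≤ s' := by
      rw [hdQ] at hBQ ⊢; push_cast at hBQ; linarith
    rcases hm.eq_or_lt with rfl | hm3
    · have h2 : (n : ℚ) ≤ q ^ 2 := by exact_mod_cast hγ rfl
      have h3 : (q : ℚ) ^ 2 ≤ k ^ 2 := pow_le_pow_left₀ (by linarith) (by linarith) 2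
      have h4 : (0 : ℚ) ≤ s' * (2 - r) := mul_nonneg hs0'.le (by linarith)
      push_cast
      linarith
    · have hm3' : (3 : ℚ) ≤ m := by exact_mod_cast hm3
      refine hsum 1 ?_ ?_
      · rw [max_eq_left (by linarith)]; linarith
      · have h2 : (s' : ℚ) * (q - 2 + r) ≤ s' * s' :=
          mul_le_mul_of_nonneg_left (by linarith) hs0'.le
        have h3 : (s' : ℚ) * s' ≤ k * k := mul_self_le_mul_self hs0'.le hks
        linarith
  · refine hsum (1 / 2) hc2 ?_
    -- With t = s' - s - 1 + γ one has k² ≥ (s' - t)² ≥ s'(s' - 2t), so it is enough to bound s' -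
    -- 2t from below.
    have hkey : 2 * (q : ℚ) - 4 + 2 * r ≤ s' - 2 * (s' - s - 1 + γ) := by
      by_cases hd : s' = s + 1
      · have hdQ : (s' : ℚ) = s + 1 := by exact_mod_cast hd
        have hγ1 : (1 : ℚ) ≤ γ := by
          have : 1 ≤ γ := Nat.one_le_iff_ne_zero.2 fun h => hC ⟨hd, h⟩
          exact_mod_cast this
        rw [hdQ] at hBQ ⊢
        nlinarith
      · have hd2 : (s : ℚ) + 2 ≤ s' := by
          have : s + 2 ≤ s' := by omega
          exact_mod_cast this
        nlinarith
    have h2 : (s' : ℚ) * (2 * (q : ℚ) - 4 + 2 * r) ≤ s' * (s' - 2 * (s' - s - 1 + γ)) :=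
      mul_le_mul_of_nonneg_left hkey hs0'.le
    have ht : (0 : ℚ) ≤ s + 1 - γ := by nlinarith
    have h3 : ((s : ℚ) + 1 - γ) ^ 2 ≤ k ^ 2 := pow_le_pow_left₀ ht hkQ 2
    nlinarith [sq_nonneg ((s' : ℚ) - s - 1 + γ)]

namespace CabCurve

variable {L : Type*} [Field L] {a b : ℕ} {X : CabCurve L a b}
variable {P : Place L X.FunField} (hP : X.IsAtInfinity P)
variable {g : X.FunField} {s s' : ℤ} {Pts : Finset (Place L X.FunField)}

section Points

variable (hfin : ∀ Q ∈ Pts, ¬ X.IsAtInfinity Q) (hrat : ∀ Q ∈ Pts, Q.IsRational)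

include hP hfin hrat in
theorem card_le_of_val_le {f : X.FunField} (hf : f ∈ X.affine) (hf0 : f ≠ 0) {n : ℤ}
    (hn : P.val f ≤ WithZero.exp n) (hzero : ∀ Q ∈ Pts, Q.val f < 1) : (Pts.card : ℤ) ≤ n := by
  obtain ⟨β, α, h⟩ := exists_isLeadingMonomial hf hf0
  rw [val_of_isLeadingMonomial hP h, WithZero.exp_le_exp] at hn
  exact le_trans (Nat.cast_le.2 (card_zeros_le hP Pts hfin hrat h hzero)) hn

include hP hfin hrat in
/-- A function with a simple pole at infinity separates rational points. -/
theorem card_le_natCard_of_val_eq [Finite L] {h : X.FunField} (hA : h ∈ X.affine)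
    (hv : P.val h = WithZero.exp 1) : Pts.card ≤ Nat.card L := by
  have hN : 1 < Nat.card L := Finite.one_lt_card
  have hvN : P.val (h ^ Nat.card L) = WithZero.exp (Nat.card L : ℤ) := by
    rw [map_pow, hv, ← WithZero.exp_nsmul, nsmul_eq_mul, mul_one]
  have hlt : P.val h < P.val (h ^ Nat.card L) := by
    rw [hv, hvN, WithZero.exp_lt_exp]
    exact_mod_cast hN
  have hvf : P.val (h ^ Nat.card L - h) = WithZero.exp (Nat.card L : ℤ) := by
    rw [Valuation.map_sub_eq_of_lt_left _ hlt, hvN]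
  -- For N the order of `L`, the function h^N - h vanishes at all these rational points and has pole
  -- order N.
  have := card_le_of_val_le hP hfin hrat (X.affine.sub_mem (X.affine.pow_mem hA _) hA)
    (ne_zero_of_val_eq_exp hvf) hvf.le fun Q hQ => by
      obtain ⟨c, hc⟩ := (hrat Q hQ).exists_hasValue (val_le_one_of_mem_affine (hfin Q hQ) hA)
      have := Fintype.ofFinite L
      have h1 := (hc.pow (Nat.card L)).add ((Place.HasValue.const Q (-1)).mul hc)
      rw [Nat.card_eq_fintype_card, FiniteField.pow_card, neg_one_mul, add_neg_cancel] at h1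
      have h2 := h1.eq_zero_iff.1 rfl
      rwa [map_neg, map_one, neg_one_mul, ← sub_eq_add_neg, ← Nat.card_eq_fintype_card] at h2
  exact_mod_cast this

include hP hfin hrat in
-- If (a - 1)(b - 1) = 0, then x or y has a simple pole at infinity.
theorem card_le_natCard_of_genus_eq_zero [Finite L] (hγ : X.genus = 0) :
    Pts.card ≤ Nat.card L := by
  have h := X.two_mul_genus
  have ha := X.a_pos
  have hb := X.b_pos
  obtain ⟨hx, hy⟩ := val_x_y_eq hP
  rw [hγ, mul_zero] at h
  rcases Nat.mul_eq_zero.1 h.symm with h | h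
  · have : a = 1 := by omega
    exact card_le_natCard_of_val_eq hP hfin hrat X.x_mem_affine (by rw [hx, this]; rfl)
  · have : b = 1 := by omega
    exact card_le_natCard_of_val_eq hP hfin hrat X.y_mem_affine (by rw [hy, this]; rfl)

include hP hfin hrat in
-- Either evaluation is injective and k is the Riemann–Roch dimension, or a nonzero function of
-- degree at most s vanishes on all of `Pts`.
theorem card_le_or_le_finrank_onePointCode (hg0 : g ≠ 0) (hgv : ∀ Q ∈ Pts, Q.val g = 1)
    (hs : 2 * (X.genus : ℤ) - 1 ≤ s) :
    (Pts.card : ℤ) ≤ s ∨ s + 1 - X.genus ≤ (Module.finrank L (X.onePointCode P Pts s g) : ℤ) := by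
  by_cases H : ∀ f ∈ X.lowDegree s, (∀ Q ∈ Pts, Q.val f < 1) → f = 0
  · right
    have hinj : Function.Injective (LinearMap.mulLeft L g⁻¹) := fun f f' h =>
      mul_left_cancel₀ (inv_ne_zero hg0) h
    rw [onePointCode_eq hP hg0, ← finrank_lowDegree hP hs, Nat.cast_le,
      (Submodule.equivMapOfInjective _ hinj (X.lowDegree s)).finrank_eq]
    refine le_finrank_evalCode _ _ ?_ ?_
    · rintro _ ⟨f, hf, rfl⟩
      obtain ⟨c, hc⟩ := exists_values hfin hrat hgv (X.lowDegree_le_affine _ hf) 1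
      exact ⟨c, fun Q => by simpa using hc Q⟩
    · rintro _ ⟨f, hf, rfl⟩ h
      rw [H f hf fun Q hQ => ?_, map_zero]
      have := (h ⟨Q, hQ⟩).eq_zero_iff.1 rfl
      simpa [hgv Q hQ] using this
  · push Not at H
    obtain ⟨f, hf, hz, hf0⟩ := H
    rw [mem_lowDegree_iff hP] at hf
    exact Or.inl (card_le_of_val_le hP hfin hrat hf.1 hf0 hf.2 hz)

end Points

section Square

variable {K : Type*} [Field K] [Finite K] [Finite L] [Algebra K L]

theorem schurProduct_dualCode_goppaLike_le (X : CabCurve L a b) (P : Place L X.FunField)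
    (Pts : Finset (Place L X.FunField)) (s : ℤ) (g : X.FunField) :
    schurProduct (dualCode (X.goppaLike K P Pts s g)) (dualCode (X.goppaLike K P Pts s g)) ≤
      schurProduct (traceCode K (X.onePointCode P Pts s g))
        (traceCode K (X.onePointCode P Pts s g)) :=
  schurProduct_mono (dualCode_subfieldSubcode_dualCode_le _)
    (dualCode_subfieldSubcode_dualCode_le _)

theorem schurProduct_dualCode_goppaLike_eq_bot (hC : X.onePointCode P Pts s g = ⊥) :
    schurProduct (dualCode (X.goppaLike K P Pts s g)) (dualCode (X.goppaLike K P Pts s g)) = ⊥ := by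
  refine eq_bot_iff.2 ((schurProduct_dualCode_goppaLike_le X P Pts s g).trans ?_)
  refine Submodule.span_le.2 ?_
  rintro _ ⟨_, ⟨c, hc, rfl⟩, d, -, rfl⟩
  rw [hC] at hc
  obtain rfl : c = 0 := hc
  rw [map_zero, zero_mul]
  exact Submodule.zero_mem _

include hP in
/-- The bound for the square in terms of any codes that contain the full trace codes. -/
theorem finrank_square_le (hg0 : g ≠ 0) (S : ℕ → Submodule K (Pts → K)) {e : ℕ}
    (he : e ≤ Module.finrank K L / 2) (hS : ∀ i ≤ e, X.fullTrace K Pts s g i ≤ S i) :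
    (Module.finrank K (schurProduct (dualCode (X.goppaLike K P Pts s g))
        (dualCode (X.goppaLike K P Pts s g))) : ℚ) ≤
      max (((Module.finrank K L : ℚ) - 1) / 2 - e) 0 * Module.finrank K L *
        (Module.finrank L (X.onePointCode P Pts s g) : ℚ) ^ 2
      + Module.finrank K (∑ i ∈ Finset.range (e + 1), S i : Submodule K (Pts → K)) := by
  refine le_trans (Nat.cast_le.2 (Submodule.finrank_mono
    (schurProduct_dualCode_goppaLike_le X P Pts s g))) ?_
  exact finrank_schurProduct_traceCode_le _ S he fun i hi =>
    (twistedSquare_onePointCode_le hP hg0 Pts s i).trans (hS i hi)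

/-- The condition under which the full trace codes `i` and `i + 1` are nested. -/
def NestingCondition (X : CabCurve L a b) (q : ℕ) (s s' : ℤ) (i : ℕ) : Prop :=
  (s' - s) * ((q : ℤ) ^ (i + 1) - (q : ℤ) ^ i + 1) + 2 * (X.genus : ℤ) - 1 ≤ s * (q : ℤ) ^ i

omit [Finite L] in
-- Multiplying the inequality by q leaves the slack (s' - s + 2γ - 1)(q - 1), nonnegative since s' -
-- s ≥ 1.
theorem NestingCondition.succ {q i : ℕ} (hq : 2 ≤ q) (hss' : s < s')
    (h : X.NestingCondition q s s' i) : X.NestingCondition q s s' (i + 1) := by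
  unfold NestingCondition at h ⊢
  have hq' : (2 : ℤ) ≤ q := by exact_mod_cast hq
  have h1 := mul_le_mul_of_nonneg_right h (by linarith : (0 : ℤ) ≤ q)
  have h2 : 0 ≤ (s' - s + 2 * (X.genus : ℤ) - 1) * ((q : ℤ) - 1) :=
    mul_nonneg (by linarith [Int.natCast_nonneg X.genus]) (by linarith)
  rw [pow_succ (q : ℤ) (i + 1), pow_succ (q : ℤ) i] at *
  nlinarith

omit [Finite L] in
theorem NestingCondition.mono {q i j : ℕ} (hq : 2 ≤ q) (hss' : s < s') (hij : i ≤ j)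
    (h : X.NestingCondition q s s' i) : X.NestingCondition q s s' j :=
  Nat.le_induction h (fun _ _ ih => ih.succ hq hss') j hij

omit [Finite L] in
theorem NestingCondition.nonneg {q i : ℕ} (hq : 2 ≤ q) (hss' : s < s')
    (h : X.NestingCondition q s s' i) : 0 ≤ s := by
  unfold NestingCondition at h
  have hpos : (0 : ℤ) < (q : ℤ) ^ i := by positivity
  have hmono : (q : ℤ) ^ i ≤ (q : ℤ) ^ (i + 1) :=
    pow_le_pow_right₀ (by exact_mod_cast (by omega : 1 ≤ q)) (Nat.le_succ i)
  by_contra! hs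
  nlinarith [mul_pos_of_neg_of_neg hs (neg_lt_zero.2 hpos)]

section Main

variable (hss' : s < s') (hgA : g ∈ X.affine) (hgd : P.val g = WithZero.exp s')
  (hfin : ∀ Q ∈ Pts, ¬ X.IsAtInfinity Q)
  (hrat : ∀ Q ∈ Pts, Q.IsRational) (hgv : ∀ Q ∈ Pts, Q.val g = 1)

include hP hss' hgA hgd hfin hrat hgv in
theorem traceT_le_of_nestingCondition {i j : ℕ} (hij : i ≤ j)
    (hi : X.NestingCondition (Nat.card K) s s' i) :
    X.traceT K P Pts s g i ≤ X.traceT K P Pts s g j := by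
  refine (traceT_le_fullTrace hP i).trans
    (le_trans ?_ (fullTrace_le_traceT hP hss' hgA hgd hfin hrat hgv j))
  induction j, hij using Nat.le_induction with
  | base => exact le_rfl
  | succ j hj ih =>
    exact ih.trans (fullTrace_le_succ hP hss' hgA hgd hfin hrat hgv
      (hi.mono two_le_natCard hss' hj))

include hP hss' hgA hgd hfin hrat hgv in
theorem sum_traceT_le {istar e : ℕ}
    (hi : X.NestingCondition (Nat.card K) s s' istar) :
    ∑ i ∈ Finset.range (e + 1), X.traceT K P Pts s g i ≤
      (X.traceT K P Pts s g e ⊔ ∑ i ∈ Finset.range istar, X.traceT K P Pts s g i) := by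
  refine sum_le_of_forall_le fun i hi' => ?_
  rcases lt_or_ge i istar with h | h
  · exact (le_sum_of_mem (Finset.mem_range.2 h)).trans le_sup_right
  · exact (traceT_le_of_nestingCondition hP hss' hgA hgd hfin hrat hgv
      (Nat.lt_succ_iff.1 (Finset.mem_range.1 hi'))
      (hi.mono two_le_natCard hss' h)).trans le_sup_left

omit [Finite K] in
include hP in
theorem finrank_fullTrace_zero_le (Pts : Finset (Place L X.FunField)) (g : X.FunField)
    (hs : 2 * (X.genus : ℤ) - 1 ≤ 2 * s) :
    (Module.finrank K (X.fullTrace K Pts s g 0) : ℤ) ≤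
      Module.finrank K L * (2 * s + 1 - X.genus) := by
  rw [← finrank_lowDegree hP hs, fullTrace, ← Nat.cast_mul, Nat.cast_le]
  have e : s * ((Nat.card K : ℤ) ^ 0 + 1) = 2 * s := by ring
  rw [e]
  exact (finrank_traceCode_le _).trans (Nat.mul_le_mul_left _
    ((finrank_evalCode_le _ _).trans (Submodule.finrank_map_le _ _)))

include hP hss' hgA hgd hfin hrat hgv in
-- The case e = i* = 0. As m ≥ 2, the index 1 is also available, which supplies the second estimate
-- for `le_bound_of_dichotomy`.
theorem finrank_square_le_of_nestingCondition_zero (hm : 2 ≤ Module.finrank K L)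
    (h : X.NestingCondition (Nat.card K) s s' 0) :
    (Module.finrank K (schurProduct (dualCode (X.goppaLike K P Pts s g))
        (dualCode (X.goppaLike K P Pts s g))) : ℚ) ≤
      ((Module.finrank K L : ℚ) - 1) / 2 * Module.finrank K L *
        (Module.finrank L (X.onePointCode P Pts s g) : ℚ) ^ 2
      + Module.finrank K L * s' * (2 - (Nat.card K : ℚ)⁻¹) := by
  have hg0 : g ≠ 0 := ne_zero_of_val_eq_exp hgd
  have hq2 : 2 ≤ Nat.card K := two_le_natCard
  have hs0 := h.nonneg hq2 hss'
  have h' := h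
  unfold NestingCondition at h'
  rw [zero_add, pow_one, pow_zero, mul_one, sub_add_cancel] at h'
  have hd : 0 ≤ (s' - s) * (Nat.card K : ℤ) := mul_nonneg (by linarith) (by positivity)
  have hs2 : 2 * (X.genus : ℤ) - 1 ≤ s := by linarith
  have hle := fun i => fullTrace_le_traceT (K := K) hP hss' hgA hgd hfin hrat hgv i
  refine le_bound_of_dichotomy (n := Pts.card) (γ := X.genus) hm hq2 hss' h' ?_ ?_ ?_
    (card_le_or_le_finrank_onePointCode hP hfin hrat hg0 hgv hs2) fun hγ => ?_
  · have h1 := finrank_square_le hP hg0 (X.fullTrace K Pts s g) (e := 0) (Nat.zero_le _)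
      fun i _ => le_rfl
    have h2 : ((Module.finrank K (X.fullTrace K Pts s g 0) : ℤ) : ℚ) ≤
        ((Module.finrank K L * (2 * s + 1 - X.genus) : ℤ) : ℚ) :=
      Int.cast_le.2 (finrank_fullTrace_zero_le hP Pts g (by linarith))
    push_cast at h2
    have hm' : (2 : ℚ) ≤ Module.finrank K L := by exact_mod_cast hm
    rw [zero_add, Finset.sum_range_one, Nat.cast_zero, sub_zero, max_eq_left (by linarith)] at h1
    exact h1.trans (by gcongr)
  · have h1 := finrank_square_le hP hg0 (X.traceT K P Pts s g) (e := 1) (by omega)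
      fun i _ => hle i
    have h3 : ∑ i ∈ Finset.range (1 + 1), X.traceT K P Pts s g i ≤ X.traceT K P Pts s g 1 := by
      have := sum_traceT_le (K := K) hP hss' hgA hgd hfin hrat hgv (e := 1) h
      rwa [Finset.sum_range_zero, Submodule.zero_eq_bot, sup_bot_eq] at this
    have h2 : ((Module.finrank K (X.traceT K P Pts s g 1) : ℤ) : ℚ) ≤
        ((Module.finrank K L * (s' * ((Nat.card K : ℤ) ^ (0 + 1) - (Nat.card K : ℤ) ^ 0 + 1)) : ℤ)
          : ℚ) := Int.cast_le.2 (finrank_traceT_succ_le hP hgA hgd Pts s 0)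
    push_cast at h2
    rw [pow_one, pow_zero, sub_add_cancel] at h2
    have h4 : (Module.finrank K (∑ i ∈ Finset.range (1 + 1), X.traceT K P Pts s g i :
        Submodule K (Pts → K)) : ℚ) ≤ Module.finrank K (X.traceT K P Pts s g 1) :=
      Nat.cast_le.2 (Submodule.finrank_mono h3)
    rw [Nat.cast_one] at h1
    linarith
  · exact (Submodule.finrank_le _).trans (by simp)
  · rw [← Module.natCard_eq_pow_finrank (K := K) (V := L)]
    exact card_le_natCard_of_genus_eq_zero hP hfin hrat hγ

include hP hss' hgA hgd hfin hrat hgv in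
theorem finrank_square_le_of_nestingCondition {e istar : ℕ} (he : e ≤ Module.finrank K L / 2)
    (hm : 2 ≤ Module.finrank K L) (hie : istar ≤ e)
    (h : X.NestingCondition (Nat.card K) s s' istar) :
    (Module.finrank K (schurProduct (dualCode (X.goppaLike K P Pts s g))
        (dualCode (X.goppaLike K P Pts s g))) : ℚ) ≤
      max (((Module.finrank K L : ℚ) - 1) / 2 - e) 0 * Module.finrank K L *
        (Module.finrank L (X.onePointCode P Pts s g) : ℚ) ^ 2
      + Module.finrank K L * s' *
        ((Nat.card K : ℚ) ^ e - (Nat.card K : ℚ) ^ ((e : ℤ) - 1) + 1)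
      + Module.finrank K
          (∑ i ∈ Finset.range istar, X.traceT K P Pts s g i : Submodule K (Pts → K))
      - Module.finrank K
          (X.traceT K P Pts s g e ⊓ ∑ i ∈ Finset.range istar, X.traceT K P Pts s g i :
            Submodule K (Pts → K)) := by
  have hg0 : g ≠ 0 := ne_zero_of_val_eq_exp hgd
  have hle := fun i => fullTrace_le_traceT (K := K) hP hss' hgA hgd hfin hrat hgv i
  rcases e with _ | e
  -- Here q^e - q^{e-1} + 1 = 2 - 1/q, and the sum over i < i* is empty.
  · obtain rfl : istar = 0 := by omega
    have h1 := finrank_square_le_of_nestingCondition_zero hP hss' hgA hgd hfin hrat hgv hm h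
    have hm' : (2 : ℚ) ≤ Module.finrank K L := by exact_mod_cast hm
    rw [Finset.sum_range_zero, Submodule.zero_eq_bot, inf_bot_eq, Nat.cast_zero, sub_zero,
      max_eq_left (by linarith), Nat.cast_zero, zero_sub, zpow_neg_one, pow_zero]
    linarith
  · set A := ∑ i ∈ Finset.range istar, X.traceT K P Pts s g i
    have h1 := finrank_square_le hP hg0 (X.traceT K P Pts s g) he fun i _ => hle i
    have h2 : (Module.finrank K (∑ i ∈ Finset.range (e + 1 + 1), X.traceT K P Pts s g i :
        Submodule K (Pts → K)) : ℚ) ≤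
          Module.finrank K (X.traceT K P Pts s g (e + 1) ⊔ A : Submodule K (Pts → K)) :=
      Nat.cast_le.2 (Submodule.finrank_mono
        (sum_traceT_le (K := K) hP hss' hgA hgd hfin hrat hgv h))
    have h3 : (Module.finrank K (X.traceT K P Pts s g (e + 1) ⊔ A : Submodule K (Pts → K)) : ℚ) +
        Module.finrank K (X.traceT K P Pts s g (e + 1) ⊓ A : Submodule K (Pts → K)) =
        Module.finrank K (X.traceT K P Pts s g (e + 1)) + Module.finrank K A := by
      exact_mod_cast Submodule.finrank_sup_add_finrank_inf_eq (X.traceT K P Pts s g (e + 1)) A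
    have h4 : ((Module.finrank K (X.traceT K P Pts s g (e + 1)) : ℤ) : ℚ) ≤
        ((Module.finrank K L * (s' * ((Nat.card K : ℤ) ^ (e + 1) - (Nat.card K : ℤ) ^ e + 1)) : ℤ)
          : ℚ) := Int.cast_le.2 (finrank_traceT_succ_le hP hgA hgd Pts s e)
    push_cast at h4
    rw [show ((e + 1 : ℕ) : ℤ) - 1 = e by push_cast; ring, zpow_natCast]
    linarith

end Main

end Square

end CabCurve

theorem mainTheorem2 {K L : Type*} [Field K] [Finite K] [Field L] [Finite L] [Algebra K L]
    (q m : ℕ) (hq : Nat.card K = q) (hm : Module.finrank K L = m)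
    {a b : ℕ} (X : CabCurve L a b)
    (Pinf : Place L X.FunField) (hPinf : X.IsAtInfinity Pinf)
    (s s' : ℤ) (hss' : s < s')
    (g : X.FunField) (hgL : g ∈ riemannRoch (Pinf.divisor s')) (hg : X.HasWeightedDegree g s')
    (Pts : Finset (Place L X.FunField)) (hrat : ∀ P ∈ Pts, P.IsRational)
    (hsupp : ∀ P ∈ Pts, P.ord g = 0)
    (k : ℕ) (hk : Module.finrank L (X.onePointCode Pinf Pts s g) = k)
    (e : ℕ) (he : e ≤ m / 2) :
    (Module.finrank K (schurProduct (dualCode (X.goppaLike K Pinf Pts s g))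
        (dualCode (X.goppaLike K Pinf Pts s g))) : ℚ)
      ≤ max (((m : ℚ) - 1) / 2 - e) 0 * m * k ^ 2
        + Module.finrank K
            (∑ i ∈ Finset.range (e + 1), X.traceT K Pinf Pts s g i : Submodule K (Pts → K)) ∧
    ∀ istar : ℕ,
      IsLeast {i : ℕ | i + 1 ≤ m / 2 ∧
        (s' - s) * ((q : ℤ) ^ (i + 1) - (q : ℤ) ^ i + 1) + 2 * (X.genus : ℤ) - 1
          ≤ s * (q : ℤ) ^ i} istar →
      istar ≤ e →
      (Module.finrank K (schurProduct (dualCode (X.goppaLike K Pinf Pts s g))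
          (dualCode (X.goppaLike K Pinf Pts s g))) : ℚ)
        ≤ max (((m : ℚ) - 1) / 2 - e) 0 * m * k ^ 2
          + m * s' * ((q : ℚ) ^ e - (q : ℚ) ^ ((e : ℤ) - 1) + 1)
          + Module.finrank K
              (∑ i ∈ Finset.range istar, X.traceT K Pinf Pts s g i : Submodule K (Pts → K))
          - Module.finrank K
              (X.traceT K Pinf Pts s g e ⊓ ∑ i ∈ Finset.range istar, X.traceT K Pinf Pts s g i :
                Submodule K (Pts → K)) := by
  subst hq hm hk
  obtain ⟨β, α, hlead, hdeg⟩ := hg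
  have hgA := X.mem_affine_of_isLeadingMonomial hlead
  have hgd := CabCurve.val_of_isLeadingMonomial hPinf hlead
  rw [hdeg] at hgd
  have hg0 := CabCurve.ne_zero_of_val_eq_exp hgd
  have hgv : ∀ Q ∈ Pts, Q.val g = 1 := fun Q hQ => by
    rw [Q.val_eq_exp_neg_ord hg0, hsupp Q hQ, neg_zero, WithZero.exp_zero]
  have hq2 : 2 ≤ Nat.card K := CabCurve.two_le_natCard
  -- For s < 0 the code is zero and the condition on i cannot hold. For s ≥ 0 one has s' > 0, so g
  -- has a pole at P∞, which keeps P∞ out of `Pts`.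
  rcases lt_or_ge s 0 with hs | hs
  · refine ⟨?_, fun istar hi _ => absurd (CabCurve.NestingCondition.nonneg hq2 hss' hi.1.2)
      (not_le.2 hs)⟩
    rw [CabCurve.schurProduct_dualCode_goppaLike_eq_bot
      (CabCurve.onePointCode_eq_bot hPinf hg0 Pts hs), finrank_bot, Nat.cast_zero]
    positivity
  · have hfin : ∀ Q ∈ Pts, ¬ X.IsAtInfinity Q := fun Q hQ hQinf => by
      have h1 := hgv Q hQ
      rw [CabCurve.eq_of_isAtInfinity hPinf hQinf, hgd, ← WithZero.exp_zero,
        WithZero.exp_inj] at h1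
      omega
    refine ⟨CabCurve.finrank_square_le hPinf hg0 _ he fun i _ =>
      CabCurve.fullTrace_le_traceT hPinf hss' hgA hgd hfin hrat hgv i, fun istar hi hie => ?_⟩
    have hm := hi.1.1
    exact CabCurve.finrank_square_le_of_nestingCondition hPinf hss' hgA hgd hfin hrat hgv he
      (by omega) hie hi.1.2
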